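/- **Notation.** For measurable $S\subset[0,1]^2$, $F\in L^\infty([0,1]^2;\mathbb C)$ and $x\in\mathbb R^3$ put $$E_SF(x)=\int_S F(\xi)\,e\big((\xi,|\xi|^2)\cdot x\big)\,d\xi,\qquad e(t)=e^{2\pi i t},\qquad EF=E_{[0,1]^2}F .$$ $B(c,r)$ denotes the ball in $\mathbb R^3$ with centre $c$ and radius $r$. For $R=n^2$ with $n\ge 1$ an integer, let $\mathcal Q_R$ be the collection of the $R$ squares $[\frac{i}{\sqrt R},\frac{i+1}{\sqrt R}]\times[\frac{j}{\sqrt R},\frac{j+1}{\sqrt R}]$, $0\le i,j<n$. An $M$-set is a union of exactly $M$ squares of $\mathcal Q_R$. Fix a real $N>3$ and put $w_{B(c,R)}(x)=(1+|x-c|/R)^{-N}$. **Large ensemble $l^3$ decoupling with parameter $\gamma>0$** is the following assertion: there is a constant $A>1$ such that for every $\epsilon>0$ there is a constant $C$ (which may depend on $\epsilon,\gamma,A,N$) with $$\int_{B(c,R)}|EF|^3\le C R^{\epsilon}\Big(\frac RM\Big)^{1/2}\sum_{j=1}^{R/M}\int_{\mathbb R^3}|E_{P_j}F|^3\,w_{B(c,R)}$$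 for all $R=n^2$ ($n\ge1$), all integers $M$ with $A^{-1}R^{1-\gamma}\le M\le A R^{1-\gamma}$, all partitions of $\mathcal Q_R$ into $M$-sets $P_1,\dots,P_{R/M}$, all $F\in L^\infty([0,1]^2)$ and all $c\in\mathbb R^3$. **Corollary 2.2.** Assume that there are $\gamma>0$ arbitrarily close to $0$ for which large ensemble $l^3$ decoupling with parameter $\gamma$ holds. Then the Restriction conjecture for the paraboloid $\mathbb P^2$ holds: for every $\epsilon>0$ there is a constant $C_\epsilon$ such that $$\int_{B(c,\sqrt R)}|EF|^3\le C_\epsilon R^{\epsilon}\,\|F\|_{L^\infty([0,1]^2)}^3$$ for all real $R\ge1$, all $c\in\mathbb R^3$ and all $F\in L^\infty([0,1]^2)$. -/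

import Mathlib

open MeasureTheory Set
open scoped ENNReal

namespace LargeEnsemble

/-- The frequency plane, carrying its Euclidean norm and Lebesgue measure. -/
abbrev Plane : Type := EuclideanSpace ℝ (Fin 2)

/-- The physical space, carrying its Euclidean norm and Lebesgue measure. -/
abbrev Space : Type := EuclideanSpace ℝ (Fin 3)

/-- The point `(ξ, |ξ|²)` of the paraboloid above `ξ`. -/
noncomputable def lift (ξ : Plane) : Space := !₂[ξ 0, ξ 1, ‖ξ‖ ^ 2]

/-- The extension operator
`E_S F(x) = ∫_S F(ξ) e((ξ, |ξ|²) · x) dξ`, where `e(t) = exp(2πit)`. -/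
noncomputable def extension (S : Set Plane) (F : Plane → ℂ) (x : Space) : ℂ :=
  ∫ ξ in S, F ξ * Complex.exp (2 * Real.pi * Complex.I * (inner ℝ (lift ξ) x : ℝ))

/-- The square `[0,1]²`. -/
def unitSquare : Set Plane := {ξ | ξ 0 ∈ Icc (0 : ℝ) 1 ∧ ξ 1 ∈ Icc (0 : ℝ) 1}

/-- The canonical square `[i/n, (i+1)/n] × [j/n, (j+1)/n]`, of side length `1/√R` where `R = n²`;
as `(i, j)` runs through `Fin n × Fin n`, these are all the canonical squares in `[0,1]²`. -/
def canonicalSquare (n : ℕ) (q : Fin n × Fin n) : Set Plane :=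
  {ξ | ξ 0 ∈ Icc ((q.1 : ℝ) / n) (((q.1 : ℝ) + 1) / n) ∧
    ξ 1 ∈ Icc ((q.2 : ℝ) / n) (((q.2 : ℝ) + 1) / n)}

/-- The union of the canonical squares whose indices lie in `s`. -/
def ensemble (n : ℕ) (s : Finset (Fin n × Fin n)) : Set Plane :=
  ⋃ q ∈ s, canonicalSquare n q

/-- The weight `(1 + |x - c| / R)^(-N)` adapted to the ball with centre `c` and radius `R`. -/
noncomputable def ballWeight (N R : ℝ) (c x : Space) : ℝ := (1 + dist x c / R) ^ (-N)

/-- Large ensemble `l^p` decoupling at the ensemble size `M ∼ R^(1-γ)`.  The scales are `R = n²`,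
so that `[0,1]²` is tiled by exactly `R` canonical squares; `A` is the constant implied in
`M ∼ R^(1-γ)`, and `N` is the order of decay of the weight on the right-hand side.  The partitions
are those of the set of all canonical squares into (necessarily `R / M`) sets of exactly `M`
squares each. -/
def LargeEnsembleDecoupling (p γ A N : ℝ) : Prop :=
  ∀ ε : ℝ, 0 < ε → ∃ C : ℝ, ∀ (n M : ℕ) (R : ℝ), 1 ≤ n → R = (n : ℝ) ^ 2 →
    A⁻¹ * R ^ (1 - γ) ≤ (M : ℝ) → (M : ℝ) ≤ A * R ^ (1 - γ) →
    ∀ P : Finpartition (Finset.univ : Finset (Fin n × Fin n)), (∀ s ∈ P.parts, s.card = M) →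
    ∀ F : Plane → ℂ, MemLp F ∞ (volume.restrict unitSquare) → ∀ c : Space,
      ∫⁻ x in Metric.closedBall c R, ‖extension unitSquare F x‖ₑ ^ p ≤
        ENNReal.ofReal (C * R ^ ε * (R / M) ^ (p / 2 - 1)) *
          ∑ s ∈ P.parts,
            ∫⁻ x, ‖extension (ensemble n s) F x‖ₑ ^ p * ENNReal.ofReal (ballWeight N R c x)

end LargeEnsemble

/-! Let `R = n²`, and suppose first that `F` is constant on canonical squares, with coefficients of
modulus at most 1, so that `EF` is a `superposition` of explicit packets. Split the `n²` squares
into `M` blocks of `m ≈ R^γ` squares. In each block, an independent uniform cyclic shift hands one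
square to each of `m` classes. Every outcome is an admissible partition, so the decoupling
inequality may be averaged over the shifts. At a fixed `x` the contribution of one class is then a
sum of `M` independent variables with total mean `EF(x) / m`. Its third moment is controlled by
`|EF(x) / m|³` plus the power 3/2 of the sum of squares of all packets (`sum_pi_norm_pow_three_le`).
With `ε = γ` the decoupling constant is of order `R^γ m^(1/2) ≈ m^(3/2)`. Summed over the `m`
classes, the mean terms carry a factor `m^(3/2) · m · m^(-3) = m^(-1/2)` and are absorbed into the
left side once `m` is large (`superposition_bound`).

What remains is the square sum against the weight of a ball of radius `R`. Constant coefficients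
make all packets pass through the origin and factor into one-dimensional oscillatory integrals. The
resulting bush is integrated directly (`lintegral_sqSum_ballWeight`), and the total loss is `n^(5γ +
δ)`.

General `F` are reached on balls of radius comparable to `n = √R`: there, moving a frequency by
`O(1/n)` changes its phase only slightly. Hence exponential sums with one arbitrary frequency near
each cap are dominated by superpositions (`expSumSup_le`), and any `EF` is an average of such sums
(`lintegral_extension_le_expSumSup`). Since `γ` can be taken below `ε / 5`, the loss is admissible.
-/

namespace LargeEnsemble

/-! ### Characters, canonical squares and their rescaling to the unit cell -/

/-- The character `x ↦ e(y · x)`. -/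
noncomputable def phase (y x : Space) : ℂ :=
  Complex.exp (2 * Real.pi * Complex.I * (inner ℝ y x : ℝ))

lemma phase_eq_exp (y x : Space) :
    phase y x = Complex.exp ((2 * Real.pi * inner ℝ y x : ℝ) * Complex.I) := by
  unfold phase; push_cast; ring_nf

@[simp] lemma norm_phase (y x : Space) : ‖phase y x‖ = 1 := by
  rw [phase_eq_exp, Complex.norm_exp_ofReal_mul_I]

lemma phase_add_right (y x z : Space) : phase y (x + z) = phase y x * phase y z := by
  unfold phase; rw [← Complex.exp_add, inner_add_right]; push_cast; ring_nf

lemma continuous_phase : Continuous fun p : Space × Space => phase p.1 p.2 := by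
  unfold phase; fun_prop

lemma continuous_lift : Continuous lift := by
  unfold lift; fun_prop

/-- The open unit square. -/
def cell : Set Plane := {w | w 0 ∈ Ioo (0 : ℝ) 1 ∧ w 1 ∈ Ioo (0 : ℝ) 1}

/-- The lower left corner of the canonical square with index `q`, scaled by `n`. -/
noncomputable def corner {n : ℕ} (q : Fin n × Fin n) : Plane := !₂[(q.1 : ℝ), (q.2 : ℝ)]

/-- The point of the canonical square with index `q` which has relative position `w`. -/
noncomputable def point (n : ℕ) (q : Fin n × Fin n) (w : Plane) : Plane :=
  (n : ℝ)⁻¹ • (w + corner q)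

/-- The uniform probability measure on the unit square. -/
noncomputable def cellMeasure : Measure Plane := volume.restrict cell

lemma point_zero (n : ℕ) (q : Fin n × Fin n) (w : Plane) :
    point n q w 0 = (q.1 + w 0) / n := by
  simp [point, corner]; ring

lemma point_one (n : ℕ) (q : Fin n × Fin n) (w : Plane) :
    point n q w 1 = (q.2 + w 1) / n := by
  simp [point, corner]; ring

lemma continuous_point (n : ℕ) (q : Fin n × Fin n) : Continuous (point n q) := by
  unfold point; fun_prop

lemma ae_coord_ne {d : ℕ} (k : Fin d) (a : ℝ) : ∀ᵐ ξ : EuclideanSpace ℝ (Fin d), ξ k ≠ a := by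
  have h := Measure.ae_eval_ne (μ := fun _ : Fin d => (volume : Measure ℝ)) k a
  exact (PiLp.volume_preserving_ofLp (Fin d)).quasiMeasurePreserving.ae h

lemma measurableSet_cell : MeasurableSet cell := by
  have h0 : Measurable fun w : Plane => w 0 := by fun_prop
  have h1 : Measurable fun w : Plane => w 1 := by fun_prop
  exact (h0 measurableSet_Ioo).inter (h1 measurableSet_Ioo)

lemma measurableSet_canonicalSquare (n : ℕ) (q : Fin n × Fin n) :
    MeasurableSet (canonicalSquare n q) := by
  have h0 : Measurable fun w : Plane => w 0 := by fun_prop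
  have h1 : Measurable fun w : Plane => w 1 := by fun_prop
  exact (h0 measurableSet_Icc).inter (h1 measurableSet_Icc)

/-- Discarding the null set of grid lines makes distinct squares genuinely disjoint and presents
each of them as a rescaled translate of `cell`. -/
lemma canonicalSquare_ae_eq {n : ℕ} (hn : 1 ≤ n) (q : Fin n × Fin n) :
    canonicalSquare n q =ᵐ[volume] {ξ | (n : ℝ) • ξ - corner q ∈ cell} := by
  have hn' : (0 : ℝ) < n := by exact_mod_cast hn
  filter_upwards [ae_coord_ne 0 (q.1 / n), ae_coord_ne 0 ((q.1 + 1) / n),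
    ae_coord_ne 1 (q.2 / n), ae_coord_ne 1 ((q.2 + 1) / n)] with ξ h1 h2 h3 h4
  apply propext
  change (_ ∧ _) ↔ (_ ∧ _)
  simp only [corner, PiLp.sub_apply, PiLp.smul_apply, smul_eq_mul, mem_Icc, mem_Ioo,
    Matrix.cons_val_zero, Matrix.cons_val_one]
  rw [div_le_iff₀ hn', div_le_iff₀ hn', le_div_iff₀ hn', le_div_iff₀ hn']
  rw [ne_eq, eq_div_iff hn'.ne'] at h1 h2 h3 h4
  constructor
  · rintro ⟨⟨a, b⟩, c, d⟩
    have := lt_of_le_of_ne a (Ne.symm h1)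
    have := lt_of_le_of_ne b h2
    have := lt_of_le_of_ne c (Ne.symm h3)
    have := lt_of_le_of_ne d h4
    refine ⟨⟨?_, ?_⟩, ?_, ?_⟩ <;> linarith
  · rintro ⟨⟨a, b⟩, c, d⟩
    refine ⟨⟨?_, ?_⟩, ?_, ?_⟩ <;> linarith

lemma setIntegral_canonicalSquare {n : ℕ} (hn : 1 ≤ n) (q : Fin n × Fin n) (f : Plane → ℂ) :
    ∫ ξ in canonicalSquare n q, f ξ = ((n : ℝ) ^ 2)⁻¹ • ∫ w, f (point n q w) ∂cellMeasure := by
  have hn' : (0 : ℝ) < n := by exact_mod_cast hn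
  rw [setIntegral_congr_set (canonicalSquare_ae_eq hn q)]
  have hm : MeasurableSet {ξ : Plane | (n : ℝ) • ξ - corner q ∈ cell} :=
    (by fun_prop : Measurable fun ξ : Plane => (n : ℝ) • ξ - corner q) measurableSet_cell
  rw [← integral_indicator hm, cellMeasure, ← integral_indicator measurableSet_cell]
  have key : ∀ ξ : Plane, ({ξ : Plane | (n : ℝ) • ξ - corner q ∈ cell}.indicator f) ξ
      = (fun ζ => cell.indicator (fun w => f (point n q w)) (ζ - corner q)) ((n : ℝ) • ξ) := by
    intro ξ
    by_cases h : (n : ℝ) • ξ - corner q ∈ cell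
    · have h' : ξ ∈ {ξ : Plane | (n : ℝ) • ξ - corner q ∈ cell} := h
      simp only [indicator_of_mem h', indicator_of_mem h]
      rw [point, sub_add_cancel, smul_smul, inv_mul_cancel₀ hn'.ne', one_smul]
    · have h' : ξ ∉ {ξ : Plane | (n : ℝ) • ξ - corner q ∈ cell} := h
      simp only [indicator_of_notMem h', indicator_of_notMem h]
  simp_rw [key]
  rw [Measure.integral_comp_smul volume
    (fun ζ => cell.indicator (fun w => f (point n q w)) (ζ - corner q)) (n : ℝ),
    finrank_euclideanSpace_fin, abs_of_nonneg (by positivity)]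
  congr 1
  exact integral_sub_right_eq_self _ (corner q)

instance : IsProbabilityMeasure cellMeasure := by
  constructor
  rw [cellMeasure, Measure.restrict_apply_univ]
  have h := (PiLp.volume_preserving_ofLp (Fin 2)).measure_preimage
    (s := Set.univ.pi fun _ => Ioo (0 : ℝ) 1)
    (MeasurableSet.univ_pi fun _ => measurableSet_Ioo).nullMeasurableSet
  rw [Real.volume_pi_Ioo] at h
  simp only [sub_zero, ENNReal.ofReal_one, Finset.prod_const_one] at h
  rw [← h]
  congr 1
  ext w
  simp [cell, Fin.forall_fin_two]

lemma canonicalSquare_aedisjoint {n : ℕ} (hn : 1 ≤ n) :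
    Pairwise (Function.onFun (AEDisjoint volume) (canonicalSquare n)) := by
  have hn' : (0 : ℝ) < n := by exact_mod_cast hn
  intro q r hqr
  refine AEDisjoint.congr (Disjoint.aedisjoint ?_) (canonicalSquare_ae_eq hn q)
    (canonicalSquare_ae_eq hn r)
  rw [Set.disjoint_left]
  rintro ξ ⟨⟨a1, a2⟩, a3, a4⟩ ⟨⟨b1, b2⟩, b3, b4⟩
  simp only [corner, PiLp.sub_apply, PiLp.smul_apply, smul_eq_mul,
    Matrix.cons_val_zero, Matrix.cons_val_one] at *
  apply hqr
  have aux : ∀ i j : Fin n, ∀ x : ℝ, 0 < x - i → x - i < 1 → 0 < x - j → x - j < 1 → i = j := by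
    intro i j x h1 h2 h3 h4
    have h5 : ((i : ℕ) : ℝ) < (j : ℕ) + 1 := by linarith
    have h6 : ((j : ℕ) : ℝ) < (i : ℕ) + 1 := by linarith
    have h7 : (i : ℕ) < j + 1 := by exact_mod_cast h5
    have h8 : (j : ℕ) < i + 1 := by exact_mod_cast h6
    exact Fin.ext (by omega)
  exact Prod.ext (aux _ _ _ a1 a2 b1 b2) (aux _ _ _ a3 a4 b3 b4)

lemma canonicalSquare_subset {n : ℕ} (hn : 1 ≤ n) (q : Fin n × Fin n) :
    canonicalSquare n q ⊆ unitSquare := by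
  have hn' : (0 : ℝ) < n := by exact_mod_cast hn
  rintro ξ ⟨⟨a1, a2⟩, a3, a4⟩
  have h (i : Fin n) : ((i : ℝ) + 1) / n ≤ 1 := by
    rw [div_le_one hn']; exact_mod_cast i.2
  have h' (i : Fin n) : 0 ≤ (i : ℝ) / n := by positivity
  exact ⟨⟨(h' _).trans a1, a2.trans (h _)⟩, (h' _).trans a3, a4.trans (h _)⟩

lemma ensemble_univ {n : ℕ} (hn : 1 ≤ n) : ensemble n Finset.univ = unitSquare := by
  have hn' : (0 : ℝ) < n := by exact_mod_cast hn
  apply Subset.antisymm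
  · exact iUnion₂_subset fun q _ => canonicalSquare_subset hn q
  · have aux : ∀ x ∈ Icc (0 : ℝ) 1, ∃ i : Fin n, x ∈ Icc ((i : ℝ) / n) (((i : ℝ) + 1) / n) := by
      rintro x ⟨h0, h1⟩
      rcases h1.lt_or_eq with h1 | rfl
      · have hx : 0 ≤ x * n := by positivity
        refine ⟨⟨⌊x * n⌋₊, ?_⟩, ?_, ?_⟩
        · rw [Nat.floor_lt hx]; nlinarith
        · rw [div_le_iff₀ hn']; exact Nat.floor_le hx
        · rw [le_div_iff₀ hn']; exact (Nat.lt_floor_add_one _).le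
      · refine ⟨⟨n - 1, by omega⟩, ?_, ?_⟩
        · rw [div_le_one hn']; exact_mod_cast Nat.sub_le _ _
        · rw [le_div_iff₀ hn', one_mul]; push_cast [Nat.cast_sub hn]; linarith
    rintro ξ ⟨h0, h1⟩
    obtain ⟨i, hi⟩ := aux _ h0
    obtain ⟨j, hj⟩ := aux _ h1
    exact mem_iUnion₂.2 ⟨(i, j), Finset.mem_univ _, hi, hj⟩

lemma extension_eq (S : Set Plane) (F : Plane → ℂ) (x : Space) :
    extension S F x = ∫ ξ in S, F ξ * phase (lift ξ) x := rfl

lemma extension_ensemble {n : ℕ} (hn : 1 ≤ n) (s : Finset (Fin n × Fin n)) {F : Plane → ℂ}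
    (hF : MemLp F ∞ (volume.restrict unitSquare)) (x : Space) :
    extension (ensemble n s) F x = ∑ q ∈ s, extension (canonicalSquare n q) F x := by
  have hfin : volume unitSquare ≠ ∞ := by
    have h := (PiLp.volume_preserving_ofLp (Fin 2)).measure_preimage
      (s := Set.univ.pi fun _ => Icc (0 : ℝ) 1)
      (MeasurableSet.univ_pi fun _ => measurableSet_Icc).nullMeasurableSet
    simp only [volume_pi_pi, Real.volume_Icc, sub_zero, ENNReal.ofReal_one,
      Finset.prod_const_one] at h
    have h2 : unitSquare = (WithLp.ofLp ⁻¹' Set.univ.pi fun _ : Fin 2 => Icc (0 : ℝ) 1) := by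
      ext w
      simp [unitSquare, Pi.le_def, Fin.forall_fin_two]; tauto
    rw [h2, h]
    exact ENNReal.one_ne_top
  have : IsFiniteMeasure (volume.restrict unitSquare) := ⟨by simpa using hfin.lt_top⟩
  have hint : IntegrableOn (fun ξ => F ξ * phase (lift ξ) x) unitSquare := by
    refine Integrable.mul_bdd (c := 1) (hF.integrable (by simp)) ?_ (by simp)
    exact (continuous_phase.comp (continuous_lift.prodMk continuous_const)).aestronglyMeasurable
  simp only [extension_eq, ensemble]
  rw [show (⋃ q ∈ s, canonicalSquare n q) = ⋃ q : s, canonicalSquare n q from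
    biUnion_eq_iUnion (s : Set (Fin n × Fin n)) fun q _ => canonicalSquare n q,
    ← Finset.sum_coe_sort s]
  rw [integral_iUnion_ae (s := fun q : s => canonicalSquare n q)
    (fun i => (measurableSet_canonicalSquare n _).nullMeasurableSet)
    (fun i j hij => canonicalSquare_aedisjoint hn fun h => hij (Subtype.ext h))
    (hint.mono_set (iUnion_subset fun q => canonicalSquare_subset hn _))]
  exact tsum_fintype _

lemma extension_canonicalSquare {n : ℕ} (hn : 1 ≤ n) (q : Fin n × Fin n) (F : Plane → ℂ)
    (x : Space) :
    extension (canonicalSquare n q) F x =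
      ((n : ℝ) ^ 2)⁻¹ • ∫ w, F (point n q w) * phase (lift (point n q w)) x ∂cellMeasure := by
  rw [extension_eq, setIntegral_canonicalSquare hn]

/-! ### Partitions given by colourings -/

/-- Surjectivity makes every colour class nonempty, as the parts of a `Finpartition` have to be. -/
lemma exists_finpartition_of_surjective {α β : Type*} [Fintype α] [DecidableEq α] [Fintype β]
    [DecidableEq β] {f : α → β} (hf : Function.Surjective f) :
    ∃ P : Finpartition (Finset.univ : Finset α),
      P.parts = Finset.univ.image fun j => Finset.univ.filter fun a => f a = j := by
  refine ⟨Finpartition.ofExistsUnique _ (fun _ _ => Finset.subset_univ _) ?_ ?_, rfl⟩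
  · intro a _
    refine ⟨Finset.univ.filter fun b => f b = f a, ?_, ?_⟩
    · simp
    · rintro t ⟨ht, hat⟩
      obtain ⟨j, -, rfl⟩ := Finset.mem_image.1 ht
      simp only [Finset.mem_filter, Finset.mem_univ, true_and] at hat
      rw [hat]
  · intro h
    obtain ⟨j, -, hj⟩ := Finset.mem_image.1 h
    obtain ⟨a, rfl⟩ := hf j
    exact Finset.notMem_empty a (hj ▸ by simp)

lemma sum_image_fibers {α β M : Type*} [Fintype α] [DecidableEq α] [Fintype β]
    [DecidableEq β] [AddCommMonoid M] {f : α → β} (hf : Function.Surjective f)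
    (g : Finset α → M) :
    ∑ s ∈ Finset.univ.image (fun j => Finset.univ.filter fun a => f a = j), g s =
      ∑ j, g (Finset.univ.filter fun a => f a = j) := by
  refine Finset.sum_image fun i _ j _ hij => ?_
  obtain ⟨a, rfl⟩ := hf i
  have : a ∈ Finset.univ.filter fun b => f b = j := by
    rw [← show (Finset.univ.filter fun b => f b = f a) = _ from hij]; simp
  simpa using this

/-! ### Moments of sums of independent variables, as sums over a finite product -/

section Moments

variable {G : Type*} [Fintype G]

lemma sum_pi_fin_succ {A : Type*} [AddCommMonoid A] {k : ℕ} (f : (Fin (k + 1) → G) → A) :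
    ∑ s, f s = ∑ s : Fin k → G, ∑ a, f (Fin.cons a s) := by
  rw [← (Fin.consEquiv fun _ : Fin (k + 1) => G).sum_comp, Fintype.sum_prod_type_right]
  rfl

lemma sum_normSq_add_le {y : G → ℂ} {σ : ℝ} (h0 : ∑ a, y a = 0)
    (hσ : ∀ a, ‖y a‖ ^ 2 ≤ σ) (t : ℂ) :
    ∑ a, ‖y a + t‖ ^ 2 ≤ Fintype.card G * (‖t‖ ^ 2 + σ) := by
  have e : ∀ a, ‖y a + t‖ ^ 2 = ‖y a‖ ^ 2 + 2 * (y a * (starRingEnd ℂ) t).re + ‖t‖ ^ 2 := by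
    intro a
    rw [← Complex.normSq_eq_norm_sq, ← Complex.normSq_eq_norm_sq, ← Complex.normSq_eq_norm_sq,
      Complex.normSq_add]
    ring
  simp_rw [e, Finset.sum_add_distrib, ← Finset.mul_sum, ← Complex.re_sum, ← Finset.sum_mul, h0]
  have := Finset.sum_le_sum fun a (_ : a ∈ Finset.univ) => hσ a
  simp at this ⊢
  nlinarith

/-- In the expansion of the fourth power the term linear in `y` sums to zero, and the cubic one is
split by the arithmetic-geometric mean inequality. -/
lemma sum_norm_pow_four_add_le {y : G → ℂ} {σ : ℝ} (h0 : ∑ a, y a = 0)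
    (hσ : ∀ a, ‖y a‖ ^ 2 ≤ σ) (t : ℂ) :
    ∑ a, ‖y a + t‖ ^ 4 ≤
      Fintype.card G * (‖t‖ ^ 4 + 8 * σ * ‖t‖ ^ 2 + 3 * σ ^ 2) := by
  have e : ∀ a, ‖y a + t‖ ^ 4 ≤ 4 * ‖t‖ ^ 2 * (y a * (starRingEnd ℂ) t).re +
      (‖t‖ ^ 4 + 8 * σ * ‖t‖ ^ 2 + 3 * σ ^ 2) := by
    intro a
    have e1 : ‖y a + t‖ ^ 2 = ‖y a‖ ^ 2 + 2 * (y a * (starRingEnd ℂ) t).re + ‖t‖ ^ 2 := by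
      rw [← Complex.normSq_eq_norm_sq, ← Complex.normSq_eq_norm_sq, ← Complex.normSq_eq_norm_sq,
        Complex.normSq_add]
      ring
    have e2 : |(y a * (starRingEnd ℂ) t).re| ≤ ‖y a‖ * ‖t‖ := by
      refine (Complex.abs_re_le_norm _).trans ?_
      simp
    set r := (y a * (starRingEnd ℂ) t).re
    have e3 : ‖y a + t‖ ^ 4 = (‖y a‖ ^ 2 + 2 * r + ‖t‖ ^ 2) ^ 2 := by rw [← e1]; ring
    have hs := hσ a
    set u := ‖y a‖
    set v := ‖t‖
    have hu : 0 ≤ u := norm_nonneg _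
    have hv : 0 ≤ v := norm_nonneg _
    have hr2 : r ^ 2 ≤ u ^ 2 * v ^ 2 := by
      rw [← mul_pow, ← sq_abs r]
      exact pow_le_pow_left₀ (abs_nonneg _) e2 2
    have hr : 4 * r * u ^ 2 ≤ 2 * (u ^ 2 * v ^ 2) + 2 * u ^ 4 := by
      have : r ≤ u * v := (le_abs_self _).trans e2
      nlinarith [sq_nonneg (u * v - u ^ 2), mul_le_mul_of_nonneg_right this (sq_nonneg u)]
    have h4 : u ^ 4 ≤ σ ^ 2 := by
      have := pow_le_pow_left₀ (sq_nonneg u) hs 2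
      nlinarith
    have h5 : u ^ 2 * v ^ 2 ≤ σ * v ^ 2 := mul_le_mul_of_nonneg_right hs (sq_nonneg v)
    rw [e3]
    nlinarith
  refine (Finset.sum_le_sum fun a _ => e a).trans (le_of_eq ?_)
  rw [Finset.sum_add_distrib, ← Finset.mul_sum, ← Complex.re_sum, ← Finset.sum_mul, h0]
  simp
  ring

lemma sum_pi_norm_sq_le {k : ℕ} (y : Fin k → G → ℂ) (σ : Fin k → ℝ)
    (h0 : ∀ b, ∑ a, y b a = 0) (hσ : ∀ b a, ‖y b a‖ ^ 2 ≤ σ b) :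
    ∑ s : Fin k → G, ‖∑ b, y b (s b)‖ ^ 2 ≤ (Fintype.card G : ℝ) ^ k * ∑ b, σ b := by
  induction k with
  | zero => simp
  | succ k ih =>
    rw [sum_pi_fin_succ]
    simp only [Fin.sum_univ_succ, Fin.cons_zero, Fin.cons_succ]
    calc _ ≤ ∑ s : Fin k → G, (Fintype.card G : ℝ) *
          (‖∑ b : Fin k, y b.succ (s b)‖ ^ 2 + σ 0) :=
        Finset.sum_le_sum fun s _ => sum_normSq_add_le (h0 0) (hσ 0) _
      _ = Fintype.card G * (∑ s : Fin k → G, ‖∑ b : Fin k, y b.succ (s b)‖ ^ 2) +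
          (Fintype.card G : ℝ) ^ (k + 1) * σ 0 := by
        rw [← Finset.mul_sum, Finset.sum_add_distrib]
        simp; ring
      _ ≤ _ := by
        have := ih (fun b => y b.succ) (fun b => σ b.succ) (fun b => h0 _) (fun b => hσ _)
        have := mul_le_mul_of_nonneg_left this (Nat.cast_nonneg (α := ℝ) (Fintype.card G))
        rw [pow_succ] at *
        linarith

/-- The constant 4 closes the induction: `4T² + 8σ₀T + 3σ₀² ≤ 4(T + σ₀)²`, where `T` is the sum of
the remaining `σ`. -/
lemma sum_pi_norm_pow_four_le {k : ℕ} (y : Fin k → G → ℂ) (σ : Fin k → ℝ)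
    (hσ0 : ∀ b, 0 ≤ σ b)
    (h0 : ∀ b, ∑ a, y b a = 0) (hσ : ∀ b a, ‖y b a‖ ^ 2 ≤ σ b) :
    ∑ s : Fin k → G, ‖∑ b, y b (s b)‖ ^ 4 ≤
      (Fintype.card G : ℝ) ^ k * (4 * (∑ b, σ b) ^ 2) := by
  induction k with
  | zero => simp
  | succ k ih =>
    rw [sum_pi_fin_succ]
    simp only [Fin.sum_univ_succ, Fin.cons_zero, Fin.cons_succ]
    calc _ ≤ ∑ s : Fin k → G, (Fintype.card G : ℝ) *
          (‖∑ b : Fin k, y b.succ (s b)‖ ^ 4 +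
            8 * σ 0 * ‖∑ b : Fin k, y b.succ (s b)‖ ^ 2 + 3 * σ 0 ^ 2) :=
        Finset.sum_le_sum fun s _ => sum_norm_pow_four_add_le (h0 0) (hσ 0) _
      _ = Fintype.card G * ((∑ s : Fin k → G, ‖∑ b : Fin k, y b.succ (s b)‖ ^ 4) +
          8 * σ 0 * (∑ s : Fin k → G, ‖∑ b : Fin k, y b.succ (s b)‖ ^ 2) +
          (Fintype.card G : ℝ) ^ k * (3 * σ 0 ^ 2)) := by
        rw [← Finset.mul_sum, Finset.sum_add_distrib, Finset.sum_add_distrib, ← Finset.mul_sum]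
        simp
      _ ≤ Fintype.card G * ((Fintype.card G : ℝ) ^ k * (4 * (∑ b : Fin k, σ b.succ) ^ 2) +
          8 * σ 0 * ((Fintype.card G : ℝ) ^ k * ∑ b : Fin k, σ b.succ) +
          (Fintype.card G : ℝ) ^ k * (3 * σ 0 ^ 2)) := by
        have h1 := ih (fun b => y b.succ) (fun b => σ b.succ) (fun b => hσ0 _) (fun b => h0 _)
          (fun b => hσ _)
        have h2 := sum_pi_norm_sq_le (fun b => y b.succ) (fun b => σ b.succ) (fun b => h0 _)
          (fun b => hσ _)
        have := hσ0 0
        gcongr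
      _ ≤ _ := by
        have : 0 ≤ (Fintype.card G : ℝ) ^ (k + 1) * σ 0 ^ 2 := by positivity
        rw [pow_succ _ k] at this ⊢
        linarith

/-- Centre each variable at its mean: the means produce the first term, and the third moment of the
centred sum is interpolated between the second and the fourth. Variances are bounded crudely by sums
over `G` instead of averages; this loses only a power of `card G`, later of order `R^γ`. -/
lemma sum_pi_norm_pow_three_le [Nonempty G] {k : ℕ} (v : Fin k → G → ℂ) :
    ∑ s : Fin k → G, ‖∑ b, v b (s b)‖ ^ 3 ≤ (Fintype.card G : ℝ) ^ k *
      (4 * (‖∑ b, ∑ a, v b a‖ / Fintype.card G) ^ 3 +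
        136 * (∑ b, ∑ a, ‖v b a‖ ^ 2) ^ (3 / 2 : ℝ)) := by
  set m : ℝ := (Fintype.card G : ℝ) with hm
  have hmpos : 0 < m := by rw [hm]; exact_mod_cast Fintype.card_pos
  set ρ : Fin k → ℝ := fun b => ∑ a, ‖v b a‖ ^ 2 with hρ
  set S : ℝ := ∑ b, ρ b with hS
  have hρ0 : ∀ b, 0 ≤ ρ b := fun b => Finset.sum_nonneg fun a _ => by positivity
  have hS0 : 0 ≤ S := Finset.sum_nonneg fun b _ => hρ0 b
  have hv : ∀ b a, ‖v b a‖ ≤ √(ρ b) := fun b a => by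
    apply Real.le_sqrt_of_sq_le
    exact Finset.single_le_sum (f := fun a => ‖v b a‖ ^ 2) (fun a _ => by positivity)
      (Finset.mem_univ a)
  set μ : Fin k → ℂ := fun b => (∑ a, v b a) / m with hμ
  have hμn : ∀ b, ‖μ b‖ ≤ √(ρ b) := fun b => by
    simp only [hμ, norm_div, Complex.norm_real, Real.norm_of_nonneg hmpos.le]
    rw [div_le_iff₀ hmpos]
    refine (norm_sum_le _ _).trans ((Finset.sum_le_sum fun a _ => hv b a).trans (le_of_eq ?_))
    simp [hm, mul_comm]
  set y : Fin k → G → ℂ := fun b a => v b a - μ b with hy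
  have hy0 : ∀ b, ∑ a, y b a = 0 := fun b => by
    have : (m : ℂ) ≠ 0 := by exact_mod_cast hmpos.ne'
    have hmc : ((Fintype.card G : ℕ) : ℂ) = (m : ℂ) := by simp [hm]
    simp only [hy, hμ, Finset.sum_sub_distrib, Finset.sum_const, Finset.card_univ, nsmul_eq_mul,
      hmc]
    field_simp
    simp
  have hyσ : ∀ b a, ‖y b a‖ ^ 2 ≤ 4 * ρ b := fun b a => by
    have h1 : ‖y b a‖ ≤ 2 * √(ρ b) := by
      refine (norm_sub_le _ _).trans ?_
      linarith [hv b a, hμn b]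
    calc _ ≤ (2 * √(ρ b)) ^ 2 := pow_le_pow_left₀ (norm_nonneg _) h1 2
      _ = 4 * ρ b := by rw [mul_pow, Real.sq_sqrt (hρ0 b)]; norm_num
  have h2 := sum_pi_norm_sq_le y (fun b => 4 * ρ b) hy0 hyσ
  have h4 := sum_pi_norm_pow_four_le y (fun b => 4 * ρ b)
    (fun b => mul_nonneg (by norm_num) (hρ0 b)) hy0 hyσ
  rw [← Finset.mul_sum, ← hS, ← hm] at h2 h4
  have h3 : ∑ s : Fin k → G, ‖∑ b, y b (s b)‖ ^ 3 ≤ m ^ k * (34 * S ^ (3 / 2 : ℝ)) := by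
    rcases hS0.eq_or_lt with h | h
    · have hb : ∀ b, ρ b = 0 := fun b =>
        (Finset.sum_eq_zero_iff_of_nonneg fun b _ => hρ0 b).1 h.symm b (Finset.mem_univ b)
      have hyz : ∀ b a, y b a = 0 := fun b a => by
        have := hyσ b a
        rw [hb, mul_zero] at this
        exact norm_eq_zero.1 (pow_eq_zero_iff (two_ne_zero) |>.1 (le_antisymm this (by positivity)))
      simp only [hyz, Finset.sum_const_zero]
      simp
      positivity
    · have hs : 0 < √S := Real.sqrt_pos.2 h
      have h32 : S ^ (3 / 2 : ℝ) * √S = S ^ 2 := by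
        rw [Real.sqrt_eq_rpow, ← Real.rpow_add h]; norm_num
      -- Interpolation by `t³√S ≤ t⁴/2 + St²/2`; the two moments contribute `32S² + 2S²`.
      refine le_of_mul_le_mul_right ?_ hs
      calc _ = ∑ s : Fin k → G, ‖∑ b, y b (s b)‖ ^ 3 * √S := Finset.sum_mul _ _ _
        _ ≤ ∑ s : Fin k → G, (1 / 2 * ‖∑ b, y b (s b)‖ ^ 4 +
            S / 2 * ‖∑ b, y b (s b)‖ ^ 2) := by
          refine Finset.sum_le_sum fun s _ => ?_
          have hsq : √S ^ 2 = S := Real.sq_sqrt hS0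
          generalize ‖∑ b, y b (s b)‖ = t
          nlinarith [mul_nonneg (sq_nonneg t) (sq_nonneg (t - √S))]
        _ = 1 / 2 * ∑ s : Fin k → G, ‖∑ b, y b (s b)‖ ^ 4 +
            S / 2 * ∑ s : Fin k → G, ‖∑ b, y b (s b)‖ ^ 2 := by
          rw [Finset.sum_add_distrib, Finset.mul_sum, Finset.mul_sum]
        _ ≤ 1 / 2 * (m ^ k * (4 * (4 * S) ^ 2)) + S / 2 * (m ^ k * (4 * S)) := by gcongr
        _ = m ^ k * (34 * S ^ (3 / 2 : ℝ)) * √S := by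
          rw [mul_assoc, mul_assoc, h32]; ring
  have hmean : ‖∑ b, μ b‖ = ‖∑ b, ∑ a, v b a‖ / m := by
    simp only [hμ, ← Finset.sum_div, norm_div, Complex.norm_real, Real.norm_of_nonneg hmpos.le]
  have hpt : ∀ s : Fin k → G, ‖∑ b, v b (s b)‖ ^ 3 ≤
      4 * (‖∑ b, ∑ a, v b a‖ / m) ^ 3 + 4 * ‖∑ b, y b (s b)‖ ^ 3 := fun s => by
    have e : ∑ b, v b (s b) = ∑ b, μ b + ∑ b, y b (s b) := by
      rw [← Finset.sum_add_distrib]; simp [hy]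
    rw [e, ← hmean]
    have h := pow_le_pow_left₀ (norm_nonneg _) (norm_add_le (∑ b, μ b) (∑ b, y b (s b))) 3
    refine h.trans ?_
    have ha := norm_nonneg (∑ b, μ b)
    have hb := norm_nonneg (∑ b, y b (s b))
    generalize ‖∑ b, μ b‖ = p at *
    generalize ‖∑ b, y b (s b)‖ = r at *
    nlinarith [mul_nonneg (add_nonneg ha hb) (sq_nonneg (p - r))]
  calc _ ≤ ∑ s : Fin k → G, (4 * (‖∑ b, ∑ a, v b a‖ / m) ^ 3 + 4 * ‖∑ b, y b (s b)‖ ^ 3) :=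
      Finset.sum_le_sum fun s _ => hpt s
    _ = m ^ k * (4 * (‖∑ b, ∑ a, v b a‖ / m) ^ 3) +
        4 * ∑ s : Fin k → G, ‖∑ b, y b (s b)‖ ^ 3 := by
      rw [Finset.sum_add_distrib]
      congr 1
      · simp [hm]
      · rw [Finset.mul_sum]
    _ ≤ _ := by linarith

end Moments

/-! ### Decay of a single packet and of rows of packets -/

/-- The one-dimensional oscillatory integral `∫₀¹ e(ty + t²τ) dt`. -/
noncomputable def osc (y τ : ℝ) : ℂ :=
  ∫ t in (0 : ℝ)..1, Complex.exp ((2 * Real.pi * (t * y + t ^ 2 * τ) : ℝ) * Complex.I)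

/-- The extension of the indicator of a canonical square, divided by the area of the square. -/
noncomputable def packet (n : ℕ) (q : Fin n × Fin n) (x : Space) : ℂ :=
  ∫ w, phase (lift (point n q w)) x ∂cellMeasure

lemma inner_lift (ξ : Plane) (x : Space) :
    inner ℝ (lift ξ) x = ξ 0 * x 0 + ξ 1 * x 1 + (ξ 0 ^ 2 + ξ 1 ^ 2) * x 2 := by
  simp [lift, PiLp.inner_apply, Fin.sum_univ_three, EuclideanSpace.norm_sq_eq, Fin.sum_univ_two]
  ring

lemma integral_cellMeasure_mul (f g : ℝ → ℂ) :
    ∫ w, f (w 0) * g (w 1) ∂cellMeasure = (∫ t in (0 : ℝ)..1, f t) * ∫ t in (0 : ℝ)..1, g t := by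
  have h1 : MeasurePreserving (fun w : Plane => (w 0, w 1)) volume volume :=
    (volume_preserving_finTwoArrow ℝ).comp (PiLp.volume_preserving_ofLp (Fin 2))
  have he : MeasurableEmbedding (fun w : Plane => (w 0, w 1)) :=
    ((MeasurableEquiv.toLp 2 (Fin 2 → ℝ)).symm.trans
      MeasurableEquiv.finTwoArrow).measurableEmbedding
  have h2 := h1.setIntegral_preimage_emb he (fun p : ℝ × ℝ => f p.1 * g p.2)
    (Ioo (0 : ℝ) 1 ×ˢ Ioo (0 : ℝ) 1)
  rw [intervalIntegral.integral_of_le zero_le_one, intervalIntegral.integral_of_le zero_le_one,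
    integral_Ioc_eq_integral_Ioo, integral_Ioc_eq_integral_Ioo, ← setIntegral_prod_mul]
  exact h2

/-- Expanding the squares of the coordinates of `point n q w` splits the phase into a part free of
`w` and one part per coordinate. The cross term gives the drift `2qτ`, with `τ = x₂/n²`. -/
lemma norm_packet (n : ℕ) (q : Fin n × Fin n) (x : Space) :
    ‖packet n q x‖ = ‖osc (x 0 / n + 2 * q.1 * (x 2 / n ^ 2)) (x 2 / n ^ 2)‖ *
      ‖osc (x 1 / n + 2 * q.2 * (x 2 / n ^ 2)) (x 2 / n ^ 2)‖ := by
  rw [← norm_mul, osc, osc, ← integral_cellMeasure_mul, packet]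
  have : ∀ w : Plane, phase (lift (point n q w)) x =
      phase (lift (point n q 0)) x * (
      Complex.exp ((2 * Real.pi * (w 0 * (x 0 / n + 2 * q.1 * (x 2 / n ^ 2)) +
        w 0 ^ 2 * (x 2 / n ^ 2)) : ℝ) * Complex.I) *
      Complex.exp ((2 * Real.pi * (w 1 * (x 1 / n + 2 * q.2 * (x 2 / n ^ 2)) +
        w 1 ^ 2 * (x 2 / n ^ 2)) : ℝ) * Complex.I)) := by
    intro w
    rw [phase_eq_exp, phase_eq_exp, ← Complex.exp_add, ← Complex.exp_add, inner_lift, inner_lift]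
    simp only [point_zero, point_one]
    congr 1
    rw [← add_mul, ← add_mul, ← Complex.ofReal_add, ← Complex.ofReal_add]
    congr 2
    simp only [PiLp.zero_apply]
    ring
  rw [integral_congr_ae (.of_forall this)]
  rw [integral_const_mul, norm_mul, norm_phase, one_mul]

lemma norm_osc_le_one (y τ : ℝ) : ‖osc y τ‖ ≤ 1 := by
  have := intervalIntegral.norm_integral_le_of_norm_le_const (a := (0 : ℝ)) (b := 1) (C := 1)
    (f := fun t => Complex.exp ((2 * Real.pi * (t * y + t ^ 2 * τ) : ℝ) * Complex.I))
    (fun t _ => by rw [Complex.norm_exp_ofReal_mul_I])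
  simpa [osc] using this

/-- Integrate the derivative of the exponential over `[0, 1]`: the linear phase yields `2πy · osc`,
the endpoints at most 2 and the quadratic phase at most `4π|τ|`. -/
lemma abs_mul_norm_osc_le (y τ : ℝ) : |y| * ‖osc y τ‖ ≤ 2 * (1 + |τ|) := by
  set u : ℝ → ℂ := fun t => Complex.exp ((2 * Real.pi * (t * y + t ^ 2 * τ) : ℝ) * Complex.I)
    with hu
  have hun : ∀ t, ‖u t‖ = 1 := fun t => Complex.norm_exp_ofReal_mul_I _
  have hd : ∀ t : ℝ, HasDerivAt u
      (u t * ((2 * Real.pi * (y + 2 * t * τ) : ℝ) * Complex.I)) t := by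
    intro t
    have h : HasDerivAt (fun t : ℝ => 2 * Real.pi * (t * y + t ^ 2 * τ))
        (2 * Real.pi * (y + 2 * t * τ)) t := by
      exact ((((hasDerivAt_id' t).mul_const y).add
        (((hasDerivAt_id' t).pow 2).mul_const τ)).const_mul (2 * Real.pi)).congr_deriv
        (by simp)
    exact (h.ofReal_comp.mul_const Complex.I).cexp
  have hc : Continuous u := by rw [hu]; fun_prop
  have hi := intervalIntegral.integral_eq_sub_of_hasDerivAt (a := 0) (b := 1)
    (fun t _ => hd t) (Continuous.intervalIntegrable (by fun_prop) _ _)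
  have hsplit : ∫ t in (0 : ℝ)..1, u t * ((2 * Real.pi * (y + 2 * t * τ) : ℝ) * Complex.I) =
      (2 * Real.pi * y : ℝ) * Complex.I * osc y τ +
      ∫ t in (0 : ℝ)..1, u t * ((4 * Real.pi * t * τ : ℝ) * Complex.I) := by
    rw [osc, ← intervalIntegral.integral_const_mul, ← intervalIntegral.integral_add
      (Continuous.intervalIntegrable (by fun_prop) _ _)
      (Continuous.intervalIntegrable (by fun_prop) _ _)]
    congr 1
    ext t
    simp only [hu]
    push_cast
    ring
  have hb : ‖∫ t in (0 : ℝ)..1, u t * ((4 * Real.pi * t * τ : ℝ) * Complex.I)‖ ≤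
      4 * Real.pi * |τ| := by
    have := intervalIntegral.norm_integral_le_of_norm_le_const (a := (0 : ℝ)) (b := 1)
      (C := 4 * Real.pi * |τ|)
      (f := fun t => u t * ((4 * Real.pi * t * τ : ℝ) * Complex.I)) (fun t ht => by
        rw [uIoc_of_le zero_le_one] at ht
        rw [norm_mul, hun, one_mul, norm_mul, Complex.norm_I, mul_one, Complex.norm_real,
          Real.norm_eq_abs, abs_mul, abs_mul, abs_of_pos (by positivity : 0 < 4 * Real.pi),
          abs_of_pos ht.1]
        have := Real.pi_pos
        have h3 := mul_le_mul_of_nonneg_left ht.2 (by positivity : 0 ≤ 4 * Real.pi * |τ|)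
        linarith)
    simpa using this
  have hmain : ‖(2 * Real.pi * y : ℝ) * Complex.I * osc y τ‖ ≤ 2 + 4 * Real.pi * |τ| := by
    have : (2 * Real.pi * y : ℝ) * Complex.I * osc y τ = (u 1 - u 0) -
        ∫ t in (0 : ℝ)..1, u t * ((4 * Real.pi * t * τ : ℝ) * Complex.I) := by
      rw [← hi, hsplit]; ring
    rw [this]
    refine (norm_sub_le _ _).trans (add_le_add ((norm_sub_le _ _).trans ?_) hb)
    rw [hun, hun]; norm_num
  rw [norm_mul, norm_mul, Complex.norm_I, mul_one, Complex.norm_real, Real.norm_eq_abs, abs_mul,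
    abs_of_pos (by positivity : 0 < 2 * Real.pi)] at hmain
  have hpi := Real.pi_gt_three
  have h0 : 0 ≤ |τ| := abs_nonneg τ
  have : Real.pi * (|y| * ‖osc y τ‖) ≤ Real.pi * (2 * (1 + |τ|)) := by nlinarith
  exact le_of_mul_le_mul_left this Real.pi_pos

/-- The decay profile of `|osc|²`. -/
noncomputable def decay (y τ : ℝ) : ℝ := (1 + (y / (1 + |τ|)) ^ 2)⁻¹

lemma decay_pos (y τ : ℝ) : 0 < decay y τ := by unfold decay; positivity

lemma decay_le_one (y τ : ℝ) : decay y τ ≤ 1 :=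
  inv_le_one_of_one_le₀ (le_add_of_nonneg_right (sq_nonneg _))

lemma norm_osc_sq_le (y τ : ℝ) : ‖osc y τ‖ ^ 2 ≤ 5 * decay y τ := by
  have h0 : 0 < 1 + |τ| := by positivity
  unfold decay
  rw [← div_eq_mul_inv, le_div_iff₀ (by positivity), div_pow, mul_add, mul_one, ← sq_abs y]
  have h1 : ‖osc y τ‖ ^ 2 ≤ 1 := pow_le_one₀ (norm_nonneg _) (norm_osc_le_one y τ)
  have h2 : ‖osc y τ‖ ^ 2 * (|y| ^ 2 / (1 + |τ|) ^ 2) ≤ 4 := by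
    rw [mul_div_assoc', div_le_iff₀ (by positivity), ← mul_pow]
    have := pow_le_pow_left₀ (by positivity) (abs_mul_norm_osc_le y τ) 2
    rw [mul_comm ‖osc y τ‖]
    linarith
  linarith

/-- Mean value theorem; a displacement of at most 2 changes `1 + a²` by a factor of at most 9. -/
lemma inv_one_add_sq_le_arctan_sub (a : ℝ) {u : ℝ} (hu : 0 ≤ u) (hu2 : u ≤ 2) :
    u * (1 + a ^ 2)⁻¹ ≤ 9 * (Real.arctan (a + u) - Real.arctan a) := by
  rcases hu.eq_or_lt with rfl | hpos
  · simp
  obtain ⟨c, hc, hd⟩ := exists_hasDerivAt_eq_slope Real.arctan (fun x => 1 / (1 + x ^ 2))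
    (lt_add_of_pos_right a hpos) Real.continuous_arctan.continuousOn
    (fun x _ => Real.hasDerivAt_arctan x)
  rw [add_sub_cancel_left, eq_div_iff hpos.ne'] at hd
  rw [← hd, one_div]
  have h1 : (1 + a ^ 2)⁻¹ ≤ 9 * (1 + c ^ 2)⁻¹ := by
    rw [← div_eq_mul_inv, le_div_iff₀ (by positivity), inv_mul_le_iff₀ (by positivity)]
    have h3 : (c - a) ^ 2 ≤ 4 := by nlinarith [hc.1, hc.2]
    nlinarith [sq_nonneg (c - 2 * a)]
  nlinarith

/-- The rescaled arguments form an arithmetic progression with step `u`, so `u` times the sum is a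
Riemann sum of `1/(1 + y²)`. It telescopes against `arctan` to at most `9π < 30`. -/
lemma sum_decay_le_of_pos (n : ℕ) (s : ℝ) {τ : ℝ} (hτ : 0 < τ) :
    ∑ i ∈ Finset.range n, decay (s + 2 * i * τ) τ ≤ 15 * (1 + 1 / τ) := by
  have h0 : 0 < 1 + |τ| := by positivity
  set u : ℝ := 2 * τ / (1 + |τ|) with hu
  have hupos : 0 < u := by positivity
  have hu2 : u ≤ 2 := by
    rw [hu, div_le_iff₀ h0, abs_of_pos hτ]; linarith
  set a : ℕ → ℝ := fun i => (s + 2 * i * τ) / (1 + |τ|) with ha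
  have hsucc : ∀ i, a (i + 1) = a i + u := by
    intro i; simp only [ha, hu]; push_cast; ring
  have h1 : u * ∑ i ∈ Finset.range n, decay (s + 2 * i * τ) τ ≤ 9 * Real.pi := by
    rw [Finset.mul_sum]
    calc _ ≤ ∑ i ∈ Finset.range n, 9 * (Real.arctan (a (i + 1)) - Real.arctan (a i)) := by
          refine Finset.sum_le_sum fun i _ => ?_
          rw [hsucc]
          exact inv_one_add_sq_le_arctan_sub (a i) hupos.le hu2
      _ = 9 * (Real.arctan (a n) - Real.arctan (a 0)) := by
          rw [← Finset.mul_sum, Finset.sum_range_sub (fun i => Real.arctan (a i))]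
      _ ≤ 9 * Real.pi := by
          have h1 := Real.arctan_lt_pi_div_two (a n)
          have h2 := Real.neg_pi_div_two_lt_arctan (a 0)
          linarith
  have h2 : u * (15 * (1 + 1 / τ)) = 30 := by
    rw [hu, abs_of_pos hτ]; field_simp; ring
  have h3 := Real.pi_lt_d2
  exact le_of_mul_le_mul_left (by linarith) hupos

lemma decay_neg (y τ : ℝ) : decay (-y) τ = decay y τ := by
  simp [decay, neg_div]

lemma decay_neg_right (y τ : ℝ) : decay y (-τ) = decay y τ := by
  simp [decay]

/-- The sum of the decay profiles over a row of canonical squares. -/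
noncomputable def rowSum (n : ℕ) (s τ : ℝ) : ℝ := ∑ i : Fin n, decay (s + 2 * (i : ℝ) * τ) τ

lemma rowSum_nonneg (n : ℕ) (s τ : ℝ) : 0 ≤ rowSum n s τ :=
  Finset.sum_nonneg fun _ _ => (decay_pos _ _).le

lemma rowSum_le_card (n : ℕ) (s τ : ℝ) : rowSum n s τ ≤ n := by
  refine (Finset.sum_le_sum fun _ _ => decay_le_one _ _).trans ?_
  simp

lemma rowSum_le (n : ℕ) (s : ℝ) {τ : ℝ} (hτ : τ ≠ 0) : rowSum n s τ ≤ 15 * (1 + 1 / |τ|) := by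
  unfold rowSum
  rw [Fin.sum_univ_eq_sum_range fun i => decay (s + 2 * (i : ℝ) * τ) τ]
  rcases hτ.lt_or_gt with h | h
  · have := sum_decay_le_of_pos n (-s) (neg_pos.2 h)
    rw [abs_of_neg h]
    convert this using 2 with i
    rw [decay_neg_right, ← decay_neg]
    congr 1
    ring
  · rw [abs_of_pos h]
    exact sum_decay_le_of_pos n s h

lemma sum_norm_packet_sq_le (n : ℕ) (x : Space) :
    ∑ q, ‖packet n q x‖ ^ 2 ≤ 25 * (rowSum n (x 0 / n) (x 2 / n ^ 2) *
      rowSum n (x 1 / n) (x 2 / n ^ 2)) := by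
  unfold rowSum
  rw [Finset.sum_mul_sum, Fintype.sum_prod_type, Finset.mul_sum]
  refine Finset.sum_le_sum fun i _ => ?_
  rw [Finset.mul_sum]
  refine Finset.sum_le_sum fun j _ => ?_
  rw [norm_packet, mul_pow]
  refine (mul_le_mul (norm_osc_sq_le _ _) (norm_osc_sq_le _ _) (by positivity)
    (mul_nonneg (by norm_num) (decay_pos _ _).le)).trans (le_of_eq ?_)
  ring

/-! ### Integrating the square sum below height `n²` -/

lemma lintegral_space {f : ℝ × ℝ × ℝ → ℝ≥0∞} (hf : Measurable f) :
    ∫⁻ x : Space, f (x 2, x 0, x 1) = ∫⁻ t, ∫⁻ a, ∫⁻ b, f (t, a, b) := by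
  have h1 : MeasurePreserving (fun x : Space => (x 2, x 0, x 1)) volume volume :=
    ((MeasurePreserving.id volume).prod (volume_preserving_finTwoArrow ℝ)).comp
      ((volume_preserving_piFinSuccAbove (fun _ : Fin 3 => ℝ) 2).comp
        (PiLp.volume_preserving_ofLp (Fin 3)))
  rw [h1.lintegral_comp hf, Measure.volume_eq_prod, lintegral_prod _ hf.aemeasurable]
  refine lintegral_congr fun t => ?_
  exact lintegral_prod (fun p : ℝ × ℝ => f (t, p)) (hf.comp measurable_prodMk_left).aemeasurable

lemma lintegral_space_mul {φ : ℝ → ℝ≥0∞} {α : ℝ → ℝ → ℝ≥0∞} (hφ : Measurable φ)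
    (hα : Measurable fun p : ℝ × ℝ => α p.1 p.2) :
    ∫⁻ x : Space, φ (x 2) * (α (x 0) (x 2) * α (x 1) (x 2)) =
      ∫⁻ t, φ t * (∫⁻ s, α s t) ^ 2 := by
  have h0 : Measurable fun p : ℝ × ℝ × ℝ => (p.2.1, p.1) := by fun_prop
  have h1 : Measurable fun p : ℝ × ℝ × ℝ => (p.2.2, p.1) := by fun_prop
  rw [lintegral_space (f := fun p => φ p.1 * (α p.2.1 p.1 * α p.2.2 p.1))
    ((hφ.comp measurable_fst).mul ((hα.comp h0).mul (hα.comp h1)))]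
  refine lintegral_congr fun t => ?_
  have hm : Measurable fun s => α s t := hα.comp (measurable_id.prodMk measurable_const)
  simp_rw [lintegral_const_mul (φ t) (hm.const_mul _), lintegral_const_mul _ hm]
  rw [lintegral_const_mul _ (hm.mul_const _), lintegral_mul_const _ hm, pow_two]

lemma lintegral_decay {n : ℕ} (hn : 1 ≤ n) (c τ : ℝ) :
    ∫⁻ s, ENNReal.ofReal (decay (s / n + c) τ) = ENNReal.ofReal (n * (1 + |τ|) * Real.pi) := by
  have hn' : (0 : ℝ) < n := by exact_mod_cast hn
  have h0 : 0 < 1 + |τ| := by positivity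
  set k : ℝ := (n * (1 + |τ|))⁻¹ with hk
  have hk0 : k ≠ 0 := by positivity
  have e : ∀ s, decay (s / n + c) τ = (fun y => (1 + (y + c / (1 + |τ|)) ^ 2)⁻¹) (k * s) := by
    intro s
    simp only [decay, hk]
    congr 3
    field_simp
  have hint : Integrable fun y : ℝ => (1 + (y + c / (1 + |τ|)) ^ 2)⁻¹ :=
    integrable_inv_one_add_sq.comp_add_right _
  simp_rw [e]
  rw [← ofReal_integral_eq_lintegral_ofReal (hint.comp_mul_left' hk0)
    (.of_forall fun s => by positivity), 
    Measure.integral_comp_mul_left (fun y : ℝ => (1 + (y + c / (1 + |τ|)) ^ 2)⁻¹) k,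
    integral_add_right_eq_self (fun y : ℝ => (1 + y ^ 2)⁻¹), integral_univ_inv_one_add_sq,
    abs_of_pos (by positivity), hk, inv_inv, smul_eq_mul]

lemma continuous_decay {X : Type*} [TopologicalSpace X] {f g : X → ℝ} (hf : Continuous f)
    (hg : Continuous g) : Continuous fun p => decay (f p) (g p) := by
  unfold decay
  refine Continuous.inv₀ ?_ fun p => by positivity
  refine continuous_const.add ((hf.div (continuous_const.add hg.abs)
    fun p => (by positivity : 1 + |g p| ≠ 0)).pow 2)

lemma continuous_rowSum {X : Type*} [TopologicalSpace X] (n : ℕ) {f g : X → ℝ}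
    (hf : Continuous f) (hg : Continuous g) : Continuous fun p => rowSum n (f p) (g p) := by
  unfold rowSum
  exact continuous_finsetSum _ fun i _ => continuous_decay (hf.add (hg.const_mul _)) hg

lemma measurable_rowSum_div (n : ℕ) : Measurable fun p : ℝ × ℝ =>
    ENNReal.ofReal (rowSum n (p.1 / n) (p.2 / n ^ 2)) :=
  (continuous_rowSum n (continuous_fst.div_const _)
    (continuous_snd.div_const _)).measurable.ennreal_ofReal

lemma lintegral_rowSum {n : ℕ} (hn : 1 ≤ n) (τ : ℝ) :
    ∫⁻ s, ENNReal.ofReal (rowSum n (s / n) τ) =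
      ENNReal.ofReal (n ^ 2 * (1 + |τ|) * Real.pi) := by
  unfold rowSum
  simp_rw [ENNReal.ofReal_sum_of_nonneg fun (i : Fin n) (_ : i ∈ Finset.univ) => (decay_pos _ _).le]
  rw [lintegral_finsetSum]
  · simp_rw [lintegral_decay hn]
    rw [Finset.sum_const, Finset.card_univ, Fintype.card_fin, nsmul_eq_mul,
      ← ENNReal.ofReal_natCast, ← ENNReal.ofReal_mul (by positivity)]
    congr 1
    ring
  · intro i _
    exact (continuous_decay (by fun_prop) continuous_const).measurable.ennreal_ofReal

lemma setLIntegral_comp_abs_le (G : ℝ → ℝ≥0∞) (hG : Measurable G) :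
    ∫⁻ t, G |t| ≤ 2 * ∫⁻ t in Ioi 0, G t := by
  rw [← lintegral_add_compl _ (measurableSet_Ioi (a := (0 : ℝ))), two_mul]
  refine add_le_add (le_of_eq ?_) (le_of_eq ?_)
  · exact setLIntegral_congr_fun measurableSet_Ioi fun t ht => by rw [abs_of_pos ht]
  · rw [compl_Ioi, setLIntegral_congr (Iio_ae_eq_Iic (a := (0 : ℝ))).symm]
    have h := (Measure.measurePreserving_neg (volume : Measure ℝ)).setLIntegral_comp_preimage
      (measurableSet_Ioi (a := (0 : ℝ))) hG
    rw [← h]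
    have hs : Neg.neg ⁻¹' Ioi (0 : ℝ) = Iio 0 := by ext; simp
    rw [hs]
    exact setLIntegral_congr_fun measurableSet_Iio fun t ht => by rw [abs_of_neg ht]

lemma setLIntegral_rpow_abs_div_le {a δ : ℝ} (ha : 0 < a) (hδ : 0 < δ) :
    ∫⁻ t, (Iio a).indicator (fun t => ENNReal.ofReal ((t / a) ^ (δ - 1))) |t| ≤
      ENNReal.ofReal (2 * a / δ) := by
  refine (setLIntegral_comp_abs_le _ (Measurable.indicator (by fun_prop) measurableSet_Iio)).trans ?_
  rw [setLIntegral_indicator measurableSet_Iio, inter_comm, Ioi_inter_Iio,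
    setLIntegral_congr (Ioo_ae_eq_Ioc (a := (0 : ℝ)) (b := a))]
  have hint : IntervalIntegrable (fun t : ℝ => (t / a) ^ (δ - 1)) volume 0 a := by
    have h := (intervalIntegral.intervalIntegrable_rpow' (a := 0) (b := 1) (r := δ - 1)
      (by linarith)).comp_mul_right (c := a⁻¹)
    simpa [div_eq_mul_inv] using h
  rw [← ofReal_integral_eq_lintegral_ofReal
    ((intervalIntegrable_iff_integrableOn_Ioc_of_le ha.le).1 hint)
    ((ae_restrict_iff' measurableSet_Ioc).2 (.of_forall fun t ht => by
      have := ht.1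
      exact Real.rpow_nonneg (by positivity) _)),
    ← intervalIntegral.integral_of_le ha.le,
    intervalIntegral.integral_comp_div (fun t => t ^ (δ - 1)) ha.ne', zero_div, div_self ha.ne',
    integral_rpow (Or.inl (by linarith)), sub_add_cancel, Real.one_rpow, Real.zero_rpow hδ.ne']
  rw [show (2 : ℝ≥0∞) = ENNReal.ofReal 2 by simp, ← ENNReal.ofReal_mul (by norm_num)]
  apply ENNReal.ofReal_le_ofReal
  rw [smul_eq_mul]
  apply le_of_eq
  ring

/-- The sum of the squares of all wave packets. -/
noncomputable def sqSum (n : ℕ) (x : Space) : ℝ := ∑ q, ‖packet n q x‖ ^ 2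

lemma sqSum_nonneg (n : ℕ) (x : Space) : 0 ≤ sqSum n x :=
  Finset.sum_nonneg fun _ _ => by positivity

lemma rpow_three_halves_le {a b : ℝ} (ha : 0 ≤ a) (hab : a ≤ b) :
    a ^ (3 / 2 : ℝ) ≤ √b * a := by
  have : a ^ (3 / 2 : ℝ) = √a * a := by
    rw [Real.sqrt_eq_rpow, show (3 / 2 : ℝ) = 1 / 2 + 1 by norm_num,
      Real.rpow_add_one' ha (by norm_num)]
  rw [this]
  exact mul_le_mul_of_nonneg_right (Real.sqrt_le_sqrt hab) ha

lemma twentyfive_rpow : (25 : ℝ) ^ (3 / 2 : ℝ) = 125 := by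
  rw [show (25 : ℝ) = 5 ^ (2 : ℝ) by norm_num, ← Real.rpow_mul (by norm_num)]
  norm_num

/-- Only half a power of each row sum is replaced by its supremum. The first powers are kept because
`lintegral_rowSum` integrates them exactly in the horizontal variables. -/
lemma sqSum_rpow_le {n : ℕ} {x : Space} {L : ℝ} (hL : 0 ≤ L)
    (h : ∀ s, rowSum n s (x 2 / n ^ 2) ≤ L) :
    sqSum n x ^ (3 / 2 : ℝ) ≤ 125 * L *
      (rowSum n (x 0 / n) (x 2 / n ^ 2) * rowSum n (x 1 / n) (x 2 / n ^ 2)) := by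
  have hA := rowSum_nonneg n (x 0 / n) (x 2 / n ^ 2)
  have hB := rowSum_nonneg n (x 1 / n) (x 2 / n ^ 2)
  calc _ ≤ (25 * (rowSum n (x 0 / n) (x 2 / n ^ 2) *
        rowSum n (x 1 / n) (x 2 / n ^ 2))) ^ (3 / 2 : ℝ) :=
        Real.rpow_le_rpow (sqSum_nonneg n x) (sum_norm_packet_sq_le n x) (by norm_num)
    _ = 125 * (rowSum n (x 0 / n) (x 2 / n ^ 2) ^ (3 / 2 : ℝ) *
        rowSum n (x 1 / n) (x 2 / n ^ 2) ^ (3 / 2 : ℝ)) := by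
        rw [Real.mul_rpow (by norm_num) (by positivity), Real.mul_rpow hA hB, twentyfive_rpow]
    _ ≤ 125 * ((√L * rowSum n (x 0 / n) (x 2 / n ^ 2)) *
        (√L * rowSum n (x 1 / n) (x 2 / n ^ 2))) := by
        gcongr
        · exact rpow_three_halves_le hA (h _)
        · exact rpow_three_halves_le hB (h _)
    _ = _ := by
        have := Real.mul_self_sqrt hL
        linear_combination 125 * (rowSum n (x 0 / n) (x 2 / n ^ 2) *
          rowSum n (x 1 / n) (x 2 / n ^ 2)) * this

/-- The bound by `1/|τ|` just fails to be integrable at 0. Geometric interpolation with the trivial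
bound `n` repairs this at the price `n^δ`. -/
lemma rowSum_le_rpow {n : ℕ} (hn : 1 ≤ n) (s : ℝ) {τ δ : ℝ} (hτ : τ ≠ 0) (hτ1 : |τ| < 1)
    (hδ : 0 < δ) (hδ1 : δ ≤ 1) :
    rowSum n s τ ≤ 30 * n ^ δ * |τ| ^ (δ - 1) := by
  have hn' : (1 : ℝ) ≤ n := by exact_mod_cast hn
  have hp : 0 < |τ| := abs_pos.2 hτ
  have h1 : rowSum n s τ ≤ 30 * |τ|⁻¹ := by
    refine (rowSum_le n s hτ).trans ?_
    have := (one_le_inv₀ hp).2 hτ1.le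
    rw [one_div]
    linarith
  have h2 : rowSum n s τ ≤ 30 * n := (rowSum_le_card n s τ).trans (by linarith)
  have h0 := rowSum_nonneg n s τ
  calc rowSum n s τ = rowSum n s τ ^ δ * rowSum n s τ ^ (1 - δ) := by
        rw [← Real.rpow_add' h0 (by simp)]; simp
    _ ≤ (30 * n) ^ δ * (30 * |τ|⁻¹) ^ (1 - δ) := by
        gcongr
    _ = _ := by
        rw [Real.mul_rpow (by norm_num) (by positivity), Real.mul_rpow (by norm_num) (by positivity),
          mul_mul_mul_comm, ← Real.rpow_add (by norm_num), Real.inv_rpow hp.le,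
          ← Real.rpow_neg hp.le, mul_assoc]
        simp

/-- The power `6 + δ` is made of `n^δ` from the row bound, `n²` from each of the two horizontal
integrals and `n²/δ` from the vertical one. In `K`, `3750 = 125 · 30`. -/
lemma lintegral_sqSum_near {n : ℕ} (hn : 1 ≤ n) {δ : ℝ} (hδ : 0 < δ) (hδ1 : δ ≤ 1) :
    ∫⁻ x in {x : Space | |x 2| < (n : ℝ) ^ 2}, ENNReal.ofReal (sqSum n x ^ (3 / 2 : ℝ)) ≤
      ENNReal.ofReal (30000 * Real.pi ^ 2 / δ * n ^ (6 + δ)) := by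
  have hn' : (0 : ℝ) < n := by exact_mod_cast hn
  have hn2 : (0 : ℝ) < (n : ℝ) ^ 2 := by positivity
  have hms : MeasurableSet {x : Space | |x 2| < (n : ℝ) ^ 2} :=
    measurableSet_lt (by fun_prop) measurable_const
  set φ : ℝ → ℝ≥0∞ := fun t => (Iio ((n : ℝ) ^ 2)).indicator
    (fun t => ENNReal.ofReal ((t / (n : ℝ) ^ 2) ^ (δ - 1))) |t| with hφ
  set K : ℝ≥0∞ := ENNReal.ofReal (3750 * n ^ δ) with hK
  have hφm : Measurable φ :=
    (Measurable.indicator (by fun_prop) measurableSet_Iio).comp (by fun_prop)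
  rw [← lintegral_indicator hms]
  calc _ ≤ ∫⁻ x : Space, (K * φ (x 2)) * (ENNReal.ofReal (rowSum n (x 0 / n) (x 2 / n ^ 2)) *
        ENNReal.ofReal (rowSum n (x 1 / n) (x 2 / n ^ 2))) := by
        refine lintegral_mono_ae ?_
        filter_upwards [ae_coord_ne (d := 3) 2 0] with x hx
        by_cases hx' : |x 2| < (n : ℝ) ^ 2
        · have hx1 : x ∈ {x : Space | |x 2| < (n : ℝ) ^ 2} := hx'
          have hx2 : |x 2| ∈ Iio ((n : ℝ) ^ 2) := hx'
          rw [indicator_of_mem hx1, hK, hφ]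
          simp only
          rw [indicator_of_mem hx2, ← ENNReal.ofReal_mul (rowSum_nonneg _ _ _),
            ← ENNReal.ofReal_mul (by positivity), ← ENNReal.ofReal_mul (by positivity)]
          apply ENNReal.ofReal_le_ofReal
          have e : |x 2 / (n : ℝ) ^ 2| = |x 2| / (n : ℝ) ^ 2 := by rw [abs_div, abs_of_pos hn2]
          refine (sqSum_rpow_le (by positivity) fun s => rowSum_le_rpow hn s
            (div_ne_zero hx hn2.ne') (by rw [e, div_lt_one hn2]; exact hx') hδ hδ1).trans
            (le_of_eq ?_)
          rw [e]
          ring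
        · rw [indicator_of_notMem (by exact hx')]
          exact bot_le
    _ = ∫⁻ t, (K * φ t) * (∫⁻ s, ENNReal.ofReal (rowSum n (s / n) (t / n ^ 2))) ^ 2 :=
        lintegral_space_mul (φ := fun t => K * φ t)
          (α := fun s t => ENNReal.ofReal (rowSum n (s / n) (t / n ^ 2)))
          (hφm.const_mul K) (measurable_rowSum_div n)
    _ ≤ ∫⁻ t, K * ENNReal.ofReal ((2 * Real.pi * n ^ 2) ^ 2) * φ t := by
        refine lintegral_mono fun t => ?_
        by_cases ht : |t| < (n : ℝ) ^ 2
        · rw [lintegral_rowSum hn, ← ENNReal.ofReal_pow (by positivity), mul_right_comm]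
          refine mul_le_mul_left (mul_le_mul_right (ENNReal.ofReal_le_ofReal ?_) _) _
          refine pow_le_pow_left₀ (by positivity) ?_ 2
          have : |t / (n : ℝ) ^ 2| ≤ 1 := by
            rw [abs_div, abs_of_pos hn2, div_le_one hn2]; exact ht.le
          have h3 := mul_le_mul_of_nonneg_left this
            (by positivity : 0 ≤ (n : ℝ) ^ 2 * Real.pi)
          linarith
        · have : φ t = 0 := by
            rw [hφ]; exact indicator_of_notMem (by simpa using ht) _
          simp [this]
    _ = K * ENNReal.ofReal ((2 * Real.pi * n ^ 2) ^ 2) * ∫⁻ t, φ t := lintegral_const_mul _ hφm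
    _ ≤ K * ENNReal.ofReal ((2 * Real.pi * n ^ 2) ^ 2) * ENNReal.ofReal (2 * n ^ 2 / δ) := by
        gcongr
        exact setLIntegral_rpow_abs_div_le hn2 hδ
    _ = _ := by
        rw [hK, ← ENNReal.ofReal_mul (by positivity), ← ENNReal.ofReal_mul (by positivity)]
        congr 1
        rw [Real.rpow_add hn']
        norm_num
        ring

/-! ### Weights adapted to balls -/

lemma ballWeight_le_one {N R : ℝ} (hN : 0 ≤ N) (hR : 0 < R) (c x : Space) :
    ballWeight N R c x ≤ 1 := by
  unfold ballWeight
  refine Real.rpow_le_one_of_one_le_of_nonpos ?_ (by linarith)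
  have : 0 ≤ dist x c / R := by positivity
  linarith

lemma measurable_ballWeight (N R : ℝ) (c : Space) : Measurable fun x => ballWeight N R c x := by
  unfold ballWeight
  exact (((measurable_id.dist measurable_const).div_const R).const_add 1).pow_const _

/-- The total mass of the weight at unit scale. -/
noncomputable def weightMass (N : ℝ) : ℝ≥0∞ :=
  ∫⁻ x : Space, ENNReal.ofReal ((1 + ‖x‖) ^ (-N))

lemma weightMass_lt_top {N : ℝ} (hN : 3 < N) : weightMass N < ∞ :=
  finite_integral_one_add_norm (by simpa using hN)

lemma lintegral_comp_smul_space {f : Space → ℝ≥0∞} (hf : Measurable f) {r : ℝ} (hr : 0 < r) :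
    ∫⁻ x, f (r⁻¹ • x) = ENNReal.ofReal (r ^ 3) * ∫⁻ x, f x := by
  rw [← lintegral_map hf (measurable_const_smul _), Measure.map_addHaar_smul volume
    (inv_ne_zero hr.ne'), lintegral_smul_measure, finrank_euclideanSpace_fin]
  rw [inv_pow, inv_inv, abs_of_pos (by positivity), smul_eq_mul]

lemma lintegral_ballWeight {R : ℝ} (hR : 0 < R) (N : ℝ) (c : Space) :
    ∫⁻ x, ENNReal.ofReal (ballWeight N R c x) = ENNReal.ofReal (R ^ 3) * weightMass N := by
  rw [weightMass, ← lintegral_comp_smul_space (by fun_prop) hR,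
    ← lintegral_sub_right_eq_self
      (fun x : Space => ENNReal.ofReal ((1 + ‖R⁻¹ • x‖) ^ (-N))) c]
  refine lintegral_congr fun x => ?_
  rw [ballWeight, norm_smul, dist_eq_norm, norm_inv, Real.norm_of_nonneg hR.le, div_eq_inv_mul]

lemma ballWeight_le_of_mem {N R : ℝ} (hN : 0 ≤ N) (hR : 0 < R) {c x y : Space}
    (h : dist y x ≤ R) : ballWeight N R c x ≤ 2 ^ N * ballWeight N R c y := by
  unfold ballWeight
  have h1 : 0 ≤ dist x c / R := by positivity
  have h2 : 0 ≤ dist y c / R := by positivity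
  have h3 : 1 + dist y c / R ≤ 2 * (1 + dist x c / R) := by
    have h4 : dist y c ≤ R + dist x c := (dist_triangle y x c).trans (by linarith)
    have h5 := (div_le_div_iff_of_pos_right hR).2 h4
    rw [add_div, div_self hR.ne'] at h5
    linarith
  have h6 := Real.rpow_le_rpow_of_nonpos (by linarith) h3 (neg_nonpos.2 hN)
  rw [Real.mul_rpow (by norm_num) (by linarith), Real.rpow_neg (by norm_num : (0 : ℝ) ≤ 2)] at h6
  have h7 : (0 : ℝ) < 2 ^ N := by positivity
  calc _ = 2 ^ N * ((2 ^ N)⁻¹ * (1 + dist x c / R) ^ (-N)) := by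
        rw [mul_inv_cancel_left₀ h7.ne']
    _ ≤ _ := by gcongr

/-- The constant in the domination of weighted integrals by integrals over balls. -/
noncomputable def weightConst (N : ℝ) : ℝ≥0∞ :=
  ENNReal.ofReal (2 ^ N) * weightMass N / volume (Metric.closedBall (0 : Space) 1)

lemma weightConst_lt_top {N : ℝ} (hN : 3 < N) : weightConst N < ∞ :=
  ENNReal.div_lt_top (ENNReal.mul_ne_top ENNReal.ofReal_ne_top (weightMass_lt_top hN).ne)
    (Metric.measure_closedBall_pos _ _ one_pos).ne'

/-- The weight varies slowly at scale `R`, so its value at `x` is at most a constant times its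
average over the ball of radius `R` about `x`. Tonelli then turns the weighted integral into ball
integrals of `f`, weighted over the centres. -/
lemma lintegral_mul_ballWeight_le {N R : ℝ} (hN : 0 ≤ N) (hR : 0 < R) {f : Space → ℝ≥0∞}
    (hf : Measurable f) {Q : ℝ≥0∞} (hQ : ∀ c, ∫⁻ x in Metric.closedBall c R, f x ≤ Q)
    (c : Space) :
    ∫⁻ x, f x * ENNReal.ofReal (ballWeight N R c x) ≤ weightConst N * Q := by
  set V := volume (Metric.closedBall (0 : Space) 1) with hV
  have hV0 : V ≠ 0 := (Metric.measure_closedBall_pos _ _ one_pos).ne'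
  have hVt : V ≠ ∞ := measure_closedBall_lt_top.ne
  set r3 := ENNReal.ofReal (R ^ 3) with hr3
  have hr0 : r3 ≠ 0 := by simp [hr3, hR]
  have hrt : r3 ≠ ∞ := ENNReal.ofReal_ne_top
  have hvol : ∀ x : Space, volume (Metric.closedBall x R) = r3 * V := fun x => by
    rw [Measure.addHaar_closedBall' _ _ hR.le, finrank_euclideanSpace_fin]
  have hw := measurable_ballWeight N R c
  have hset : MeasurableSet {p : Space × Space | dist p.2 p.1 ≤ R} :=
    measurableSet_le (by fun_prop) measurable_const
  set k : Space → Space → ℝ≥0∞ := fun x y =>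
    {p : Space × Space | dist p.2 p.1 ≤ R}.indicator (fun _ => 1) (x, y) with hk
  have hkm : Measurable fun p : Space × Space => k p.1 p.2 :=
    measurable_const.indicator hset
  have hpt : ∀ x, r3 * V * ENNReal.ofReal (ballWeight N R c x) ≤
      ENNReal.ofReal (2 ^ N) * ∫⁻ y, k x y * ENNReal.ofReal (ballWeight N R c y) := by
    intro x
    rw [← lintegral_const_mul' _ _ ENNReal.ofReal_ne_top, ← hvol x, mul_comm, ← setLIntegral_const,
      ← lintegral_indicator measurableSet_closedBall]
    refine lintegral_mono fun y => ?_
    by_cases h : dist y x ≤ R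
    · have h1 : y ∈ Metric.closedBall x R := h
      have h2 : (x, y) ∈ {p : Space × Space | dist p.2 p.1 ≤ R} := h
      simp only [hk]
      rw [indicator_of_mem h1, indicator_of_mem h2, one_mul, ← ENNReal.ofReal_mul (by positivity)]
      exact ENNReal.ofReal_le_ofReal (ballWeight_le_of_mem hN hR h)
    · have h1 : y ∉ Metric.closedBall x R := h
      rw [indicator_of_notMem h1]
      exact bot_le
  have hball : ∀ y, ∫⁻ x, f x * k x y ≤ Q := by
    intro y
    refine le_trans (le_of_eq ?_) (hQ y)
    rw [← lintegral_indicator measurableSet_closedBall]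
    refine lintegral_congr fun x => ?_
    by_cases h : dist y x ≤ R
    · have h1 : x ∈ Metric.closedBall y R := by rwa [Metric.mem_closedBall, dist_comm]
      have h2 : (x, y) ∈ {p : Space × Space | dist p.2 p.1 ≤ R} := h
      simp only [hk]
      rw [indicator_of_mem h1, indicator_of_mem h2, mul_one]
    · have h1 : x ∉ Metric.closedBall y R := by rwa [Metric.mem_closedBall, dist_comm]
      have h2 : (x, y) ∉ {p : Space × Space | dist p.2 p.1 ≤ R} := h
      simp only [hk]
      rw [indicator_of_notMem h1, indicator_of_notMem h2, mul_zero]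
  have hmain : r3 * V * ∫⁻ x, f x * ENNReal.ofReal (ballWeight N R c x) ≤
      ENNReal.ofReal (2 ^ N) * (Q * (r3 * weightMass N)) := by
    calc _ = ∫⁻ x, f x * (r3 * V * ENNReal.ofReal (ballWeight N R c x)) := by
          rw [← lintegral_const_mul' _ _ (ENNReal.mul_ne_top hrt hVt)]
          exact lintegral_congr fun x => by ring
      _ ≤ ∫⁻ x, ENNReal.ofReal (2 ^ N) *
            ∫⁻ y, f x * k x y * ENNReal.ofReal (ballWeight N R c y) := by
          refine lintegral_mono fun x => ?_
          refine (mul_le_mul_right (hpt x) (f x)).trans (le_of_eq ?_)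
          have hx : Measurable fun y => k x y * ENNReal.ofReal (ballWeight N R c y) :=
            (hkm.comp (measurable_const.prodMk measurable_id)).mul hw.ennreal_ofReal
          simp_rw [mul_assoc (f x)]
          rw [lintegral_const_mul _ hx]
          ring
      _ = ENNReal.ofReal (2 ^ N) *
            ∫⁻ y, ∫⁻ x, f x * k x y * ENNReal.ofReal (ballWeight N R c y) := by
          rw [lintegral_const_mul' _ _ ENNReal.ofReal_ne_top, lintegral_lintegral_swap]
          exact (((hf.comp measurable_fst).mul hkm).mul
            (hw.ennreal_ofReal.comp measurable_snd)).aemeasurable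
      _ ≤ ENNReal.ofReal (2 ^ N) * ∫⁻ y, Q * ENNReal.ofReal (ballWeight N R c y) := by
          gcongr with y
          rw [lintegral_mul_const' _ _ ENNReal.ofReal_ne_top]
          gcongr
          exact hball y
      _ = _ := by
          rw [lintegral_const_mul _ hw.ennreal_ofReal, lintegral_ballWeight hR]
  have hrV0 : r3 * V ≠ 0 := mul_ne_zero hr0 hV0
  have hrVt : r3 * V ≠ ∞ := ENNReal.mul_ne_top hrt hVt
  rw [← ENNReal.mul_le_mul_iff_right hrV0 hrVt]
  refine hmain.trans (le_of_eq ?_)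
  rw [weightConst, div_eq_mul_inv]
  calc _ = (V * V⁻¹) * (ENNReal.ofReal (2 ^ N) * (Q * (r3 * weightMass N))) := by
        rw [ENNReal.mul_inv_cancel hV0 hVt, one_mul]
    _ = _ := by ring

/-! ### The weighted square sum over all of space -/

/-- At such heights the packets have spread and every row sum is at most 30; the constant is `125 ·
30³`. -/
lemma sqSum_rpow_le_of_one_le {n : ℕ} (hn : 1 ≤ n) {x : Space} (hx : (n : ℝ) ^ 2 ≤ |x 2|) :
    sqSum n x ^ (3 / 2 : ℝ) ≤ 3375000 := by
  have hn2 : (0 : ℝ) < (n : ℝ) ^ 2 := by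
    have : (0 : ℝ) < n := by exact_mod_cast hn
    positivity
  have hτ : 1 ≤ |x 2 / (n : ℝ) ^ 2| := by
    rwa [abs_div, abs_of_pos hn2, one_le_div hn2]
  have h : ∀ s, rowSum n s (x 2 / n ^ 2) ≤ 30 := fun s => by
    refine (rowSum_le n s (abs_pos.1 (one_pos.trans_le hτ))).trans ?_
    have := (div_le_one (by linarith)).2 hτ
    linarith
  refine (sqSum_rpow_le (by norm_num) h).trans ?_
  have := mul_le_mul (h (x 0 / n)) (h (x 1 / n)) (rowSum_nonneg _ _ _) (by norm_num)
  linarith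

/-- Below height `n²` the weight is dropped. Above it the square sum is bounded and the weight has
mass of order `n⁶`. -/
lemma lintegral_sqSum_ballWeight {N : ℝ} (hN : 3 < N) {δ : ℝ} (hδ : 0 < δ) :
    ∃ C : ℝ, 0 ≤ C ∧ ∀ n : ℕ, 1 ≤ n → ∀ c : Space,
      ∫⁻ x, ENNReal.ofReal (sqSum n x ^ (3 / 2 : ℝ)) *
        ENNReal.ofReal (ballWeight N ((n : ℝ) ^ 2) c x) ≤ ENNReal.ofReal (C * n ^ (6 + δ)) := by
  set ρ := min δ 1 with hρ
  have hρ0 : 0 < ρ := lt_min hδ one_pos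
  refine ⟨30000 * Real.pi ^ 2 / ρ + 3375000 * (weightMass N).toReal, by positivity,
    fun n hn c => ?_⟩
  have hn1 : (1 : ℝ) ≤ n := by exact_mod_cast hn
  have hn2 : (0 : ℝ) < (n : ℝ) ^ 2 := by positivity
  have hms : MeasurableSet {x : Space | |x 2| < (n : ℝ) ^ 2} :=
    measurableSet_lt (by fun_prop) measurable_const
  rw [← lintegral_add_compl _ hms, add_mul, ENNReal.ofReal_add (by positivity) (by positivity)]
  refine add_le_add ?_ ?_
  · calc _ ≤ ∫⁻ x in {x : Space | |x 2| < (n : ℝ) ^ 2},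
          ENNReal.ofReal (sqSum n x ^ (3 / 2 : ℝ)) := by
          refine lintegral_mono fun x => ?_
          refine mul_le_of_le_one_right' ?_
          exact ENNReal.ofReal_le_one.2 (ballWeight_le_one (by linarith) hn2 c x)
      _ ≤ _ := lintegral_sqSum_near hn hρ0 (min_le_right _ _)
      _ ≤ _ := by
          apply ENNReal.ofReal_le_ofReal
          gcongr
          exact min_le_left _ _
  · calc _ ≤ ∫⁻ x in {x : Space | |x 2| < (n : ℝ) ^ 2}ᶜ,
          ENNReal.ofReal 3375000 * ENNReal.ofReal (ballWeight N ((n : ℝ) ^ 2) c x) := by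
          refine setLIntegral_mono' hms.compl fun x hx => ?_
          gcongr
          exact sqSum_rpow_le_of_one_le hn (not_lt.1 hx)
      _ ≤ ∫⁻ x, ENNReal.ofReal 3375000 * ENNReal.ofReal (ballWeight N ((n : ℝ) ^ 2) c x) :=
          setLIntegral_le_lintegral _ _
      _ = ENNReal.ofReal (3375000 * (((n : ℝ) ^ 2) ^ 3 * (weightMass N).toReal)) := by
          rw [lintegral_const_mul' _ _ ENNReal.ofReal_ne_top, lintegral_ballWeight hn2,
            ENNReal.ofReal_mul (by norm_num), ENNReal.ofReal_mul (by positivity),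
            ENNReal.ofReal_toReal (weightMass_lt_top hN).ne]
      _ ≤ _ := by
          apply ENNReal.ofReal_le_ofReal
          have : ((n : ℝ) ^ 2) ^ 3 ≤ (n : ℝ) ^ (6 + δ) := by
            rw [← pow_mul, ← Real.rpow_natCast]
            refine Real.rpow_le_rpow_of_exponent_le hn1 ?_
            push_cast
            linarith
          have := mul_le_mul_of_nonneg_right this
            (by positivity : 0 ≤ 3375000 * (weightMass N).toReal)
          linarith

/-! ### Functions constant on canonical squares -/

@[fun_prop]
lemma continuous_packet (n : ℕ) (q : Fin n × Fin n) : Continuous (packet n q) := by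
  unfold packet
  refine continuous_of_dominated (bound := fun _ => 1) (fun x => ?_) (fun x => ?_)
    (integrable_const _) (.of_forall fun w => ?_)
  · exact (continuous_phase.comp ((continuous_lift.comp (continuous_point n q)).prodMk
      continuous_const)).aestronglyMeasurable
  · exact .of_forall fun w => by simp
  · exact continuous_phase.comp (continuous_const.prodMk continuous_id)

/-- The function which equals `c q` on the interior of the canonical square with index `q`. -/
noncomputable def stepFun (n : ℕ) (c : Fin n × Fin n → ℂ) (ξ : Plane) : ℂ :=
  ∑ q, {ξ : Plane | (n : ℝ) • ξ - corner q ∈ cell}.indicator (fun _ => c q) ξ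

lemma stepFun_point {n : ℕ} (c : Fin n × Fin n → ℂ) (q : Fin n × Fin n) {w : Plane}
    (hw : w ∈ cell) : stepFun n c (point n q w) = c q := by
  have hn : (n : ℝ) ≠ 0 := by
    have := q.1.pos
    positivity
  have e : ∀ r : Fin n × Fin n, (n : ℝ) • point n q w - corner r = w + corner q - corner r := by
    intro r
    rw [point, smul_smul, mul_inv_cancel₀ hn, one_smul]
  rw [stepFun, Finset.sum_eq_single q]
  · refine indicator_of_mem ?_ _
    change _ ∈ cell
    rwa [e, add_sub_cancel_right]
  · intro r _ hr
    refine indicator_of_notMem (fun h => hr ?_) _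
    change _ ∈ cell at h
    rw [e] at h
    obtain ⟨⟨a1, a2⟩, a3, a4⟩ := hw
    obtain ⟨⟨b1, b2⟩, b3, b4⟩ := h
    simp only [corner, PiLp.sub_apply, PiLp.add_apply,
      Matrix.cons_val_zero, Matrix.cons_val_one] at *
    have aux : ∀ i j : Fin n, ∀ x : ℝ, 0 < x → x < 1 → 0 < x + i - j → x + i - j < 1 → j = i := by
      intro i j x h1 h2 h3 h4
      have h5 : ((i : ℕ) : ℝ) < (j : ℕ) + 1 := by linarith
      have h6 : ((j : ℕ) : ℝ) < (i : ℕ) + 1 := by linarith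
      have h7 : (i : ℕ) < j + 1 := by exact_mod_cast h5
      have h8 : (j : ℕ) < i + 1 := by exact_mod_cast h6
      exact Fin.ext (by omega)
    exact Prod.ext (aux _ _ _ a1 a2 b1 b2) (aux _ _ _ a3 a4 b3 b4)
  · exact fun h => absurd (Finset.mem_univ q) h

lemma memLp_stepFun (n : ℕ) (c : Fin n × Fin n → ℂ) (μ : Measure Plane) :
    MemLp (stepFun n c) ∞ μ := by
  refine memLp_top_of_bound (C := ∑ q, ‖c q‖) (Measurable.aestronglyMeasurable ?_)
    (.of_forall fun ξ => (norm_sum_le _ _).trans (Finset.sum_le_sum fun q _ => ?_))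
  · refine Finset.measurable_sum _ fun q _ => measurable_const.indicator ?_
    exact (by fun_prop : Measurable fun ξ : Plane => (n : ℝ) • ξ - corner q) measurableSet_cell
  · exact norm_indicator_le_norm_self (fun _ => c q) ξ

/-- The superposition of the wave packets with coefficients `c`. -/
noncomputable def superposition (n : ℕ) (c : Fin n × Fin n → ℂ) (x : Space) : ℂ :=
  ∑ q, ((n : ℝ) ^ 2)⁻¹ • (c q * packet n q x)

lemma continuous_superposition (n : ℕ) (c : Fin n × Fin n → ℂ) :
    Continuous (superposition n c) :=
  continuous_finsetSum _ fun q _ => by fun_prop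

lemma extension_ensemble_stepFun {n : ℕ} (hn : 1 ≤ n) (s : Finset (Fin n × Fin n))
    (c : Fin n × Fin n → ℂ) (x : Space) :
    extension (ensemble n s) (stepFun n c) x =
      ∑ q ∈ s, ((n : ℝ) ^ 2)⁻¹ • (c q * packet n q x) := by
  rw [extension_ensemble hn s (memLp_stepFun n c _)]
  refine Finset.sum_congr rfl fun q _ => ?_
  rw [extension_canonicalSquare hn, packet, ← integral_const_mul]
  congr 1
  refine integral_congr_ae ?_
  filter_upwards [ae_restrict_mem measurableSet_cell] with w hw
  rw [stepFun_point c q hw]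

lemma extension_unitSquare_stepFun {n : ℕ} (hn : 1 ≤ n) (c : Fin n × Fin n → ℂ) (x : Space) :
    extension unitSquare (stepFun n c) x = superposition n c x := by
  rw [← ensemble_univ hn, extension_ensemble_stepFun hn, superposition]

lemma norm_packet_le_one (n : ℕ) (q : Fin n × Fin n) (x : Space) : ‖packet n q x‖ ≤ 1 := by
  rw [norm_packet]
  exact mul_le_one₀ (norm_osc_le_one _ _) (norm_nonneg _) (norm_osc_le_one _ _)

lemma norm_superposition_le_one {n : ℕ} {c : Fin n × Fin n → ℂ} (hc : ∀ q, ‖c q‖ ≤ 1) (x : Space) :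
    ‖superposition n c x‖ ≤ 1 := by
  rcases Nat.eq_zero_or_pos n with rfl | hn
  · simp [superposition]
  have hn' : (0 : ℝ) < n := by exact_mod_cast hn
  calc _ ≤ ∑ q : Fin n × Fin n, ((n : ℝ) ^ 2)⁻¹ := by
        refine (norm_sum_le _ _).trans (Finset.sum_le_sum fun q _ => ?_)
        rw [norm_smul, norm_inv, norm_pow, Real.norm_of_nonneg hn'.le, norm_mul]
        exact mul_le_of_le_one_right (by positivity)
          (mul_le_one₀ (hc q) (norm_nonneg _) (norm_packet_le_one n q x))
    _ = 1 := by
        rw [Finset.sum_const, Finset.card_univ, Fintype.card_prod, Fintype.card_fin, nsmul_eq_mul]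
        push_cast
        field_simp

lemma enorm_rpow_three (z : ℂ) : ‖z‖ₑ ^ (3 : ℝ) = ENNReal.ofReal (‖z‖ ^ 3) := by
  rw [← ofReal_norm, ENNReal.ofReal_rpow_of_nonneg (norm_nonneg _) (by norm_num)]
  norm_cast

/-! ### Averaging decoupling over shifted partitions -/

section Shifts

variable {n M : ℕ} {G : Type*} [AddCommGroup G]

/-- The colouring of the canonical squares obtained from an enumeration by `Fin M × G`, by
shifting each of the `M` blocks. -/
def shiftColour (e : Fin M × G ≃ Fin n × Fin n) (s : Fin M → G) (q : Fin n × Fin n) : G :=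
  (e.symm q).2 - s (e.symm q).1

lemma sum_filter_shiftColour [DecidableEq G] {A : Type*} [AddCommMonoid A] (e : Fin M × G ≃ Fin n × Fin n)
    (s : Fin M → G) (j : G) (f : Fin n × Fin n → A) :
    ∑ q ∈ Finset.univ.filter (fun q => shiftColour e s q = j), f q =
      ∑ b, f (e (b, s b + j)) := by
  symm
  refine Finset.sum_bij (fun b _ => e (b, s b + j)) (fun b _ => ?_) (fun b _ b' _ h => ?_)
    (fun q hq => ?_) (fun _ _ => rfl)
  · exact Finset.mem_filter.2 ⟨Finset.mem_univ _, by simp [shiftColour]⟩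
  · exact (Prod.ext_iff.1 (e.injective h)).1
  · refine ⟨(e.symm q).1, Finset.mem_univ _, ?_⟩
    rw [← (Finset.mem_filter.1 hq).2, shiftColour, add_sub_cancel, Prod.mk.eta,
      Equiv.apply_symm_apply]

lemma shiftColour_surjective [NeZero M] (e : Fin M × G ≃ Fin n × Fin n) (s : Fin M → G) :
    Function.Surjective (shiftColour e s) := fun j => ⟨e (0, s 0 + j), by simp [shiftColour]⟩

lemma card_filter_shiftColour [DecidableEq G] (e : Fin M × G ≃ Fin n × Fin n) (s : Fin M → G) (j : G) :
    (Finset.univ.filter fun q => shiftColour e s q = j).card = M := by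
  rw [Finset.card_eq_sum_ones, sum_filter_shiftColour]
  simp

/-- Translation by `j` permutes `G`, so neither the mean nor the square sum depends on the class
`j`. -/
lemma sum_norm_pow_three_shift_le [Fintype G] (e : Fin M × G ≃ Fin n × Fin n)
    {c : Fin n × Fin n → ℂ} (hc : ∀ q, ‖c q‖ ≤ 1) (x : Space) (j : G) :
    ∑ s : Fin M → G, ‖∑ b, ((n : ℝ) ^ 2)⁻¹ • (c (e (b, s b + j)) * packet n (e (b, s b + j)) x)‖ ^ 3
      ≤ (Fintype.card G : ℝ) ^ M * (4 * (‖superposition n c x‖ / Fintype.card G) ^ 3 +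
        136 * (sqSum n x / (n : ℝ) ^ 4) ^ (3 / 2 : ℝ)) := by
  have : Nonempty G := ⟨0⟩
  refine (sum_pi_norm_pow_three_le fun b a =>
    ((n : ℝ) ^ 2)⁻¹ • (c (e (b, a + j)) * packet n (e (b, a + j)) x)).trans ?_
  have key {A : Type} [AddCommMonoid A] (f : Fin n × Fin n → A) :
      ∑ b, ∑ a, f (e (b, a + j)) = ∑ q, f q := by
    rw [← e.sum_comp, Fintype.sum_prod_type]
    exact Finset.sum_congr rfl fun b _ => Equiv.sum_comp (Equiv.addRight j) fun a => f (e (b, a))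
  rw [key fun q => ((n : ℝ) ^ 2)⁻¹ • (c q * packet n q x), ← superposition,
    key fun q => ‖((n : ℝ) ^ 2)⁻¹ • (c q * packet n q x)‖ ^ 2]
  gcongr
  rw [sqSum, Finset.sum_div]
  refine Finset.sum_le_sum fun q _ => ?_
  rw [norm_smul, norm_mul, norm_inv, norm_pow, RCLike.norm_natCast, mul_pow, mul_pow,
    inv_pow, ← pow_mul, div_eq_inv_mul]
  gcongr
  exact mul_le_of_le_one_left (by positivity) (pow_le_one₀ (norm_nonneg _) (hc q))

end Shifts

/-- The left side is the same for all `m^M` shift vectors: sum the inequality over them, apply the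
moment bound pointwise in `x`, and divide. -/
lemma lintegral_superposition_le_of_decoupling {n M m : ℕ} (hn : 1 ≤ n) (hM : M * m = n ^ 2)
    {c : Fin n × Fin n → ℂ} (hc : ∀ q, ‖c q‖ ≤ 1) {N R : ℝ} {B : ℝ≥0∞} (x₀ : Space)
    (h : ∀ P : Finpartition (Finset.univ : Finset (Fin n × Fin n)),
      (∀ s ∈ P.parts, s.card = M) →
      ∫⁻ x in Metric.closedBall x₀ R, ‖extension unitSquare (stepFun n c) x‖ₑ ^ (3 : ℝ) ≤
        B * ∑ s ∈ P.parts, ∫⁻ x, ‖extension (ensemble n s) (stepFun n c) x‖ₑ ^ (3 : ℝ) *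
          ENNReal.ofReal (ballWeight N R x₀ x)) :
    ∫⁻ x in Metric.closedBall x₀ R, ENNReal.ofReal (‖superposition n c x‖ ^ 3) ≤
      B * m * ∫⁻ x, ENNReal.ofReal (4 * (‖superposition n c x‖ / m) ^ 3 +
        136 * (sqSum n x / (n : ℝ) ^ 4) ^ (3 / 2 : ℝ)) * ENNReal.ofReal (ballWeight N R x₀ x) := by
  have hn2 : 0 < M * m := by rw [hM]; positivity
  have : NeZero m := ⟨(Nat.pos_of_mul_pos_left hn2).ne'⟩
  have : NeZero M := ⟨(Nat.pos_of_mul_pos_right hn2).ne'⟩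
  -- Any enumeration serves: the position of the squares within a block plays no role.
  have e : Fin M × ZMod m ≃ Fin n × Fin n := Fintype.equivOfCardEq (by simp [hM, pow_two])
  simp only [extension_unitSquare_stepFun hn, extension_ensemble_stepFun hn, enorm_rpow_three] at h
  set T := ∫⁻ x in Metric.closedBall x₀ R, ENNReal.ofReal (‖superposition n c x‖ ^ 3) with hT
  set H : Space → ℝ := fun x => 4 * (‖superposition n c x‖ / m) ^ 3 +
        136 * (sqSum n x / (n : ℝ) ^ 4) ^ (3 / 2 : ℝ) with hH
  set f : (Fin M → ZMod m) → ZMod m → Space → ℝ := fun s j x =>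
    ‖∑ b, ((n : ℝ) ^ 2)⁻¹ • (c (e (b, s b + j)) * packet n (e (b, s b + j)) x)‖ ^ 3 with hf
  have hfm : ∀ s j, Measurable fun x => ENNReal.ofReal (f s j x) *
      ENNReal.ofReal (ballWeight N R x₀ x) := by
    intro s j
    refine Measurable.mul (Measurable.ennreal_ofReal ?_) (measurable_ballWeight N R x₀).ennreal_ofReal
    refine (Continuous.pow (Continuous.norm ?_) 3).measurable
    exact continuous_finsetSum _ fun b _ => by fun_prop
  have h1 : ∀ s : Fin M → ZMod m, T ≤ B * ∑ j, ∫⁻ x, ENNReal.ofReal (f s j x) *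
      ENNReal.ofReal (ballWeight N R x₀ x) := by
    intro s
    have hsurj := shiftColour_surjective e s
    obtain ⟨P, hP⟩ := exists_finpartition_of_surjective hsurj
    have h2 := h P ?_
    · rw [hP, sum_image_fibers hsurj] at h2
      simpa only [sum_filter_shiftColour] using h2
    · rw [hP]
      intro t ht
      obtain ⟨j, -, rfl⟩ := Finset.mem_image.1 ht
      exact card_filter_shiftColour e s j
  have h3 := Finset.sum_le_sum fun s (_ : s ∈ Finset.univ) => h1 s
  rw [← Finset.mul_sum, Finset.sum_comm, Finset.sum_const, Finset.card_univ, Fintype.card_fun,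
    Fintype.card_fin, ZMod.card, nsmul_eq_mul] at h3
  have h4 : ∀ j, ∑ s, ∫⁻ x, ENNReal.ofReal (f s j x) * ENNReal.ofReal (ballWeight N R x₀ x) ≤
      ((m ^ M : ℕ) : ℝ≥0∞) * ∫⁻ x, ENNReal.ofReal (H x) * ENNReal.ofReal (ballWeight N R x₀ x) := by
    intro j
    rw [← lintegral_finsetSum _ fun s _ => hfm s j, ← lintegral_const_mul' _ _ (by simp)]
    refine lintegral_mono fun x => ?_
    rw [← Finset.sum_mul, ← ENNReal.ofReal_sum_of_nonneg fun s _ => by positivity, ← mul_assoc]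
    refine mul_le_mul_left ?_ _
    rw [← ENNReal.ofReal_natCast, ← ENNReal.ofReal_mul (by positivity)]
    refine ENNReal.ofReal_le_ofReal ?_
    have := sum_norm_pow_three_shift_le e hc x j
    rw [ZMod.card] at this
    rw [Nat.cast_pow]
    exact this
  have h5 := h3.trans (mul_le_mul_right (Finset.sum_le_sum fun j _ => h4 j) B)
  rw [Finset.sum_const, Finset.card_univ, ZMod.card, nsmul_eq_mul] at h5
  have hm0 : ((m ^ M : ℕ) : ℝ≥0∞) ≠ 0 := by
    have := NeZero.ne m
    positivity
  rw [← ENNReal.mul_le_mul_iff_right hm0 (by simp)]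
  refine h5.trans (le_of_eq ?_)
  ring

/-! ### Absorbing the mean term -/

lemma lintegral_average_le {N : ℝ} (hN : 3 < N) {δ S : ℝ} {n m : ℕ} (hn : 1 ≤ n) (hm : 1 ≤ m)
    {c : Fin n × Fin n → ℂ} {Q : ℝ} (x₀ : Space)
    (hQ : ∀ x₁, ∫⁻ x in Metric.closedBall x₁ ((n : ℝ) ^ 2),
      ENNReal.ofReal (‖superposition n c x‖ ^ 3) ≤ ENNReal.ofReal Q)
    (hsq : ∫⁻ x, ENNReal.ofReal (sqSum n x ^ (3 / 2 : ℝ)) *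
        ENNReal.ofReal (ballWeight N ((n : ℝ) ^ 2) x₀ x) ≤ ENNReal.ofReal (S * n ^ (6 + δ))) :
    ∫⁻ x, ENNReal.ofReal (4 * (‖superposition n c x‖ / m) ^ 3 +
        136 * (sqSum n x / (n : ℝ) ^ 4) ^ (3 / 2 : ℝ)) *
        ENNReal.ofReal (ballWeight N ((n : ℝ) ^ 2) x₀ x) ≤
      ENNReal.ofReal (4 / (m : ℝ) ^ 3) * (weightConst N * ENNReal.ofReal Q) +
        ENNReal.ofReal (136 * S * n ^ δ) := by
  have hn' : (0 : ℝ) < n := by exact_mod_cast hn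
  have hn2 : (0 : ℝ) < (n : ℝ) ^ 2 := by positivity
  have hw := (measurable_ballWeight N ((n : ℝ) ^ 2) x₀).ennreal_ofReal
  have hg : Measurable fun x => ENNReal.ofReal (‖superposition n c x‖ ^ 3) :=
    ((continuous_superposition n c).norm.pow 3).measurable.ennreal_ofReal
  calc _ = ∫⁻ x, (ENNReal.ofReal (4 / (m : ℝ) ^ 3) * (ENNReal.ofReal (‖superposition n c x‖ ^ 3) *
          ENNReal.ofReal (ballWeight N ((n : ℝ) ^ 2) x₀ x)) +
        ENNReal.ofReal (136 / (n : ℝ) ^ 6) * (ENNReal.ofReal (sqSum n x ^ (3 / 2 : ℝ)) *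
          ENNReal.ofReal (ballWeight N ((n : ℝ) ^ 2) x₀ x))) := by
        refine lintegral_congr fun x => ?_
        have h0 := sqSum_nonneg n x
        rw [← mul_assoc, ← mul_assoc, ← ENNReal.ofReal_mul (p := 4 / (m : ℝ) ^ 3) (by positivity),
          ← ENNReal.ofReal_mul (p := 136 / (n : ℝ) ^ 6) (by positivity), ← add_mul,
          ← ENNReal.ofReal_add (by positivity) (by positivity)]
        congr 2
        rw [Real.div_rpow h0 (by positivity), div_pow,
          show ((n : ℝ) ^ 4) ^ (3 / 2 : ℝ) = (n : ℝ) ^ 6 by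
            rw [← Real.rpow_natCast, ← Real.rpow_mul hn'.le, ← Real.rpow_natCast]; norm_num]
        ring
    _ = ENNReal.ofReal (4 / (m : ℝ) ^ 3) * (∫⁻ x, ENNReal.ofReal (‖superposition n c x‖ ^ 3) *
          ENNReal.ofReal (ballWeight N ((n : ℝ) ^ 2) x₀ x)) +
        ENNReal.ofReal (136 / (n : ℝ) ^ 6) * (∫⁻ x, ENNReal.ofReal (sqSum n x ^ (3 / 2 : ℝ)) *
          ENNReal.ofReal (ballWeight N ((n : ℝ) ^ 2) x₀ x)) := by
        have hgw : Measurable fun x => ENNReal.ofReal (4 / (m : ℝ) ^ 3) *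
          (ENNReal.ofReal (‖superposition n c x‖ ^ 3) *
            ENNReal.ofReal (ballWeight N ((n : ℝ) ^ 2) x₀ x)) := (hg.mul hw).const_mul _
        rw [lintegral_add_left hgw,
          lintegral_const_mul' _ _ ENNReal.ofReal_ne_top,
          lintegral_const_mul' _ _ ENNReal.ofReal_ne_top]
    _ ≤ ENNReal.ofReal (4 / (m : ℝ) ^ 3) * (weightConst N * ENNReal.ofReal Q) +
        ENNReal.ofReal (136 / (n : ℝ) ^ 6) * ENNReal.ofReal (S * n ^ (6 + δ)) := by
        gcongr
        exact lintegral_mul_ballWeight_le (by linarith) hn2 hg hQ x₀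
    _ = _ := by
        rw [← ENNReal.ofReal_mul (by positivity)]
        congr 2
        rw [Real.rpow_add hn', show (n : ℝ) ^ (6 : ℝ) = (n : ℝ) ^ 6 by norm_cast]
        field_simp

lemma superposition_bound {N γ A δ : ℝ} (hN : 3 < N) (hA : 1 < A) (hγ : 0 < γ)
    (hD : LargeEnsembleDecoupling 3 γ A N) (hδ : 0 < δ) :
    ∃ C K : ℝ, 0 ≤ C ∧ ∀ n m M : ℕ, 1 ≤ n → M * m = n ^ 2 →
      A⁻¹ * ((n : ℝ) ^ 2) ^ γ ≤ m → (m : ℝ) ≤ A * ((n : ℝ) ^ 2) ^ γ → K ≤ √m →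
      ∀ c : Fin n × Fin n → ℂ, (∀ q, ‖c q‖ ≤ 1) → ∀ x₀ : Space,
        ∫⁻ x in Metric.closedBall x₀ ((n : ℝ) ^ 2), ENNReal.ofReal (‖superposition n c x‖ ^ 3) ≤
          ENNReal.ofReal (C * n ^ (5 * γ + δ)) := by
  -- The exponent `ε = γ` makes the decoupling loss `R^γ` comparable to `m`.
  obtain ⟨C₀, hC₀⟩ := hD γ hγ
  obtain ⟨S, hS, hsq⟩ := lintegral_sqSum_ballWeight hN hδ
  set C₁ := |C₀| with hC₁
  set W := (weightConst N).toReal with hW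
  refine ⟨2 * (136 * S) * (C₁ * A ^ (3 / 2 : ℝ)), 8 * C₁ * A * W, by positivity,
    fun n m M hn hM hm1 hm2 hK c hc x₀ => ?_⟩
  have hn' : (0 : ℝ) < n := by exact_mod_cast hn
  have hA0 : 0 < A := by linarith
  have hMm : 0 < M * m := by rw [hM]; positivity
  have hmn : 0 < m := Nat.pos_of_mul_pos_left hMm
  have hMn : 0 < M := Nat.pos_of_mul_pos_right hMm
  have hm0 : (0 : ℝ) < m := by exact_mod_cast hmn
  have hM0 : (0 : ℝ) < M := by exact_mod_cast hMn
  set R : ℝ := (n : ℝ) ^ 2 with hR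
  have hR0 : 0 < R := by positivity
  have hMR : (M : ℝ) * m = R := by rw [hR]; exact_mod_cast hM
  have hRγ : 0 < R ^ γ := by positivity
  have hM' : (M : ℝ) = R / m := by rw [← hMR]; field_simp
  have hRM : R / M = m := by rw [← hMR]; field_simp
  have hMl : A⁻¹ * R ^ (1 - γ) ≤ M := by
    rw [hM', Real.rpow_sub hR0, Real.rpow_one, le_div_iff₀ hm0]
    calc _ ≤ A⁻¹ * (R / R ^ γ) * (A * R ^ γ) := by gcongr
      _ = R := by field_simp
  have hMu : (M : ℝ) ≤ A * R ^ (1 - γ) := by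
    rw [hM', Real.rpow_sub hR0, Real.rpow_one, div_le_iff₀ hm0]
    calc R = A * (R / R ^ γ) * (A⁻¹ * R ^ γ) := by field_simp
      _ ≤ _ := by gcongr
  set B : ℝ := C₁ * R ^ γ * √m with hB
  have hB0 : 0 ≤ B := by positivity
  -- The weight reaches beyond the given ball, so the quantity that absorbs is the supremum over all
  -- centres. It is finite because superpositions are bounded by 1.
  set Q : ℝ≥0∞ := ⨆ x₁ : Space, ∫⁻ x in Metric.closedBall x₁ R,
    ENNReal.ofReal (‖superposition n c x‖ ^ 3) with hQ
  have hQt : Q ≠ ∞ := by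
    have : Q ≤ volume (Metric.closedBall (0 : Space) R) := by
      refine iSup_le fun x₁ => ?_
      rw [← Measure.addHaar_closedBall_center volume x₁, ← setLIntegral_one]
      refine lintegral_mono fun x => ?_
      exact ENNReal.ofReal_le_one.2
        (pow_le_one₀ (norm_nonneg _) (norm_superposition_le_one hc x))
    exact ne_top_of_le_ne_top measure_closedBall_lt_top.ne this
  set q := Q.toReal with hq
  have hqQ : ENNReal.ofReal q = Q := ENNReal.ofReal_toReal hQt
  have hq0 : 0 ≤ q := ENNReal.toReal_nonneg
  have hball : ∀ x₁, ∫⁻ x in Metric.closedBall x₁ R,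
      ENNReal.ofReal (‖superposition n c x‖ ^ 3) ≤ ENNReal.ofReal q := fun x₁ => by
    rw [hqQ]
    exact le_iSup (fun x₁ => ∫⁻ x in Metric.closedBall x₁ R,
      ENNReal.ofReal (‖superposition n c x‖ ^ 3)) x₁
  have hstep : ∀ x₁, ∫⁻ x in Metric.closedBall x₁ R,
      ENNReal.ofReal (‖superposition n c x‖ ^ 3) ≤
      ENNReal.ofReal (B * m * (4 / (m : ℝ) ^ 3 * (W * q) + 136 * S * n ^ δ)) := by
    intro x₁
    refine (lintegral_superposition_le_of_decoupling (N := N) hn hM hc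
      (B := ENNReal.ofReal B) x₁ fun P hP => ?_).trans ?_
    · refine (hC₀ n M R hn rfl hMl hMu P hP (stepFun n c) (memLp_stepFun n c _) x₁).trans ?_
      refine mul_le_mul_left (ENNReal.ofReal_le_ofReal ?_) _
      rw [hRM, hB, Real.sqrt_eq_rpow, show (3 / 2 - 1 : ℝ) = 1 / 2 by norm_num]
      gcongr
      exact le_abs_self _
    · refine (mul_le_mul_right (lintegral_average_le hN hn hmn x₁ hball (hsq n hn x₁)) _).trans
        (le_of_eq ?_)
      rw [← ENNReal.ofReal_toReal (weightConst_lt_top hN).ne, ← hW,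
        ← ENNReal.ofReal_natCast m, ← ENNReal.ofReal_mul (by positivity),
        ← ENNReal.ofReal_mul (by positivity), ← ENNReal.ofReal_mul (by positivity),
        ← ENNReal.ofReal_add (by positivity) (by positivity), ← ENNReal.ofReal_mul (by positivity)]
  have hqle : q ≤ B * m * (4 / (m : ℝ) ^ 3 * (W * q) + 136 * S * n ^ δ) := by
    rw [← ENNReal.ofReal_le_ofReal_iff (by positivity), hqQ]
    exact iSup_le hstep
  have hRm : R ^ γ ≤ A * m := by
    rwa [inv_mul_le_iff₀ hA0] at hm1
  have hsq0 : 0 < √(m : ℝ) := Real.sqrt_pos.2 hm0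
  have hss : √(m : ℝ) * √m = m := Real.mul_self_sqrt hm0.le
  -- The coefficient of `q` is at most `4 C₁ A W / √m`, and the threshold `8 C₁ A W` on `√m` makes
  -- it at most 1/2.
  have habs : B * m * (4 / (m : ℝ) ^ 3 * (W * q)) ≤ q / 2 := by
    have h1 : B * m * (4 / (m : ℝ) ^ 3 * W) ≤ 1 / 2 := by
      calc _ ≤ C₁ * (A * m) * √m * m * (4 / (m : ℝ) ^ 3 * W) := by rw [hB]; gcongr
        _ = 4 * C₁ * A * W * √m / m := by field_simp
        _ = 4 * C₁ * A * W / √m := by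
          rw [div_eq_div_iff hm0.ne' hsq0.ne', mul_assoc, hss]
        _ ≤ 1 / 2 := by rw [div_le_iff₀ hsq0]; linarith
    have := mul_le_mul_of_nonneg_right h1 hq0
    linarith
  have hfin : q ≤ 2 * (136 * S) * (C₁ * A ^ (3 / 2 : ℝ)) * n ^ (5 * γ + δ) := by
    have h1 : q ≤ 2 * (B * m * (136 * S * n ^ δ)) := by linarith
    refine h1.trans ?_
    -- The `5γ` in the exponent is `2γ` from `R^γ` plus `3γ` from `m^(3/2)`.
    have h2 : √(m : ℝ) * m ≤ A ^ (3 / 2 : ℝ) * (n : ℝ) ^ (3 * γ) := by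
      have e : √(m : ℝ) * m = (m : ℝ) ^ (3 / 2 : ℝ) := by
        rw [Real.sqrt_eq_rpow, ← Real.rpow_add_one hm0.ne']; norm_num
      rw [e]
      refine (Real.rpow_le_rpow hm0.le hm2 (by norm_num)).trans (le_of_eq ?_)
      rw [Real.mul_rpow hA0.le hRγ.le, hR, ← Real.rpow_natCast, ← Real.rpow_mul hn'.le,
        ← Real.rpow_mul hn'.le]
      congr 2
      push_cast
      ring
    have h3 : R ^ γ = (n : ℝ) ^ (2 * γ) := by
      rw [hR, ← Real.rpow_natCast, ← Real.rpow_mul hn'.le]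
      norm_num
    have h4 : (n : ℝ) ^ (5 * γ + δ) = (n : ℝ) ^ (2 * γ) * (n : ℝ) ^ (3 * γ) * (n : ℝ) ^ δ := by
      rw [← Real.rpow_add hn', ← Real.rpow_add hn']
      congr 1
      ring
    rw [hB, h3, h4]
    calc _ = 2 * (136 * S) * C₁ * (n : ℝ) ^ (2 * γ) * (n : ℝ) ^ δ * (√(m : ℝ) * m) := by ring
      _ ≤ 2 * (136 * S) * C₁ * (n : ℝ) ^ (2 * γ) * (n : ℝ) ^ δ *
          (A ^ (3 / 2 : ℝ) * (n : ℝ) ^ (3 * γ)) := by gcongr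
      _ = _ := by ring
  exact (hball x₀).trans (ENNReal.ofReal_le_ofReal hfin)

/-! ### Exponential sums with one frequency near each cap -/

/-- Jensen's inequality for the probability measure `ν`, then Tonelli. -/
lemma lintegral_norm_integral_pow_three_le {Ω X : Type*} [MeasurableSpace Ω] [MeasurableSpace X]
    {ν : Measure Ω} [IsProbabilityMeasure ν] {μ : Measure X} [SFinite μ] {H : Ω → X → ℂ}
    (hH : Measurable fun p : Ω × X => H p.1 p.2) {K : ℝ≥0∞}
    (hK : ∀ᵐ ω ∂ν, ∫⁻ x, ENNReal.ofReal (‖H ω x‖ ^ 3) ∂μ ≤ K) :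
    ∫⁻ x, ENNReal.ofReal (‖∫ ω, H ω x ∂ν‖ ^ 3) ∂μ ≤ K := by
  have hpt : ∀ x, ENNReal.ofReal (‖∫ ω, H ω x ∂ν‖ ^ 3) ≤
      ∫⁻ ω, ENNReal.ofReal (‖H ω x‖ ^ 3) ∂ν := by
    intro x
    have hm : Measurable fun ω => H ω x := hH.comp (measurable_id.prodMk measurable_const)
    have h := eLpNorm'_le_eLpNorm'_of_exponent_le (μ := ν) one_pos
      (by norm_num : (1 : ℝ) ≤ 3) hm.aestronglyMeasurable
    simp only [eLpNorm', ENNReal.rpow_one, div_one] at h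
    have h2 := ENNReal.rpow_le_rpow h (by norm_num : (0 : ℝ) ≤ 3)
    rw [← ENNReal.rpow_mul, one_div_mul_cancel (by norm_num), ENNReal.rpow_one] at h2
    simp only [← enorm_rpow_three]
    exact (ENNReal.rpow_le_rpow (enorm_integral_le_lintegral_enorm _) (by norm_num)).trans h2
  calc _ ≤ ∫⁻ x, ∫⁻ ω, ENNReal.ofReal (‖H ω x‖ ^ 3) ∂ν ∂μ := lintegral_mono hpt
    _ = ∫⁻ ω, ∫⁻ x, ENNReal.ofReal (‖H ω x‖ ^ 3) ∂μ ∂ν := by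
        refine lintegral_lintegral_swap (f := fun x ω => ENNReal.ofReal (‖H ω x‖ ^ 3)) ?_
        exact ((hH.comp measurable_swap).norm.pow_const 3).ennreal_ofReal.aemeasurable
    _ ≤ ∫⁻ _, K ∂ν := lintegral_mono_ae hK
    _ = K := by simp

/-- An exponential sum with one frequency for each canonical square. -/
noncomputable def expSum (n : ℕ) (c : Fin n × Fin n → ℂ) (y : Fin n × Fin n → Space)
    (x : Space) : ℂ :=
  ∑ q, ((n : ℝ) ^ 2)⁻¹ • (c q * phase (y q) x)

/-- The frequency `y q` lies in a box of side `8 / n` around the corner of the cap above the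
canonical square with index `q`. -/
def InBoxes (n : ℕ) (y : Fin n × Fin n → Space) : Prop :=
  ∀ q i, |y q i - lift (point n q 0) i| ≤ 4 / n

lemma norm_expSum_le_one {n : ℕ} {c : Fin n × Fin n → ℂ} (hc : ∀ q, ‖c q‖ ≤ 1)
    (y : Fin n × Fin n → Space) (x : Space) : ‖expSum n c y x‖ ≤ 1 := by
  rcases Nat.eq_zero_or_pos n with rfl | hn
  · simp [expSum]
  have hn' : (0 : ℝ) < n := by exact_mod_cast hn
  calc _ ≤ ∑ q : Fin n × Fin n, ((n : ℝ) ^ 2)⁻¹ := by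
        refine (norm_sum_le _ _).trans (Finset.sum_le_sum fun q _ => ?_)
        rw [norm_smul, norm_inv, norm_pow, Real.norm_of_nonneg hn'.le, norm_mul, norm_phase, mul_one]
        exact mul_le_of_le_one_right (by positivity) (hc q)
    _ = 1 := by
        rw [Finset.sum_const, Finset.card_univ, Fintype.card_prod, Fintype.card_fin, nsmul_eq_mul]
        push_cast
        field_simp

lemma inBoxes_point {n : ℕ} {w : Plane} (hw : w ∈ cell) :
    InBoxes n fun q => lift (point n q w) := by
  intro q i
  have hn : (1 : ℝ) ≤ n := by exact_mod_cast q.1.pos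
  have hn' : (0 : ℝ) < n := by linarith
  obtain ⟨⟨a1, a2⟩, a3, a4⟩ := hw
  have aux : ∀ k : Fin n, ∀ t : ℝ, 0 < t → t < 1 →
      0 ≤ ((k + t) / n) ^ 2 - ((k : ℝ) / n) ^ 2 ∧
      ((k + t) / n) ^ 2 - ((k : ℝ) / n) ^ 2 ≤ 2 / n := by
    intro k t h0 h1
    have hk : ((k : ℕ) : ℝ) + 1 ≤ n := by exact_mod_cast k.2
    have hk0 : (0 : ℝ) ≤ (k : ℕ) := by positivity
    have e : ((k + t) / n) ^ 2 - ((k : ℝ) / n) ^ 2 = t * (2 * k + t) / n ^ 2 := by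
      field_simp
      ring
    rw [e]
    refine ⟨by positivity, ?_⟩
    rw [div_le_div_iff₀ (by positivity) hn']
    have h2 : t * (2 * k + t) ≤ 1 * (2 * n) :=
      mul_le_mul h1.le (by linarith) (by positivity) (by norm_num)
    have := mul_le_mul_of_nonneg_right h2 hn'.le
    linarith
  have hq (ξ : Plane) : lift ξ 0 = ξ 0 ∧ lift ξ 1 = ξ 1 ∧ lift ξ 2 = ξ 0 ^ 2 + ξ 1 ^ 2 := by
    refine ⟨rfl, rfl, ?_⟩
    simp [lift, EuclideanSpace.norm_sq_eq, Fin.sum_univ_two]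
  fin_cases i
  · change |lift _ 0 - lift _ 0| ≤ _
    rw [(hq _).1, (hq _).1, point_zero, point_zero, PiLp.zero_apply, add_zero, ← sub_div,
      add_sub_cancel_left, abs_of_nonneg (by positivity)]
    gcongr
    linarith
  · change |lift _ 1 - lift _ 1| ≤ _
    rw [(hq _).2.1, (hq _).2.1, point_one, point_one, PiLp.zero_apply, add_zero, ← sub_div,
      add_sub_cancel_left, abs_of_nonneg (by positivity)]
    gcongr
    linarith
  · change |lift _ 2 - lift _ 2| ≤ _
    rw [(hq _).2.2, (hq _).2.2, point_zero, point_zero, point_one, point_one, PiLp.zero_apply,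
      PiLp.zero_apply, add_zero, add_zero]
    obtain ⟨b1, b2⟩ := aux q.1 _ a1 a2
    obtain ⟨b3, b4⟩ := aux q.2 _ a3 a4
    have e : (4 : ℝ) / n = 2 / n + 2 / n := by ring
    rw [e, abs_le]
    constructor <;> linarith

/-- Boxes are convex, whereas a segment between two points of a cap leaves the paraboloid; hence
frequencies are allowed to fill boxes. -/
lemma InBoxes.lineMap {n : ℕ} {y z : Fin n × Fin n → Space} (hy : InBoxes n y) (hz : InBoxes n z)
    {t : ℝ} (h0 : 0 ≤ t) (h1 : t ≤ 1) : InBoxes n fun q => y q + t • (z q - y q) := by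
  intro q i
  have h2 := abs_le.1 (hy q i)
  have h3 := abs_le.1 (hz q i)
  simp only [PiLp.add_apply, PiLp.smul_apply, PiLp.sub_apply, smul_eq_mul]
  rw [abs_le]
  constructor <;> nlinarith

lemma hasDerivAt_phase (y d x : Space) (t : ℝ) :
    HasDerivAt (fun t : ℝ => phase (y + t • d) x)
      (phase (y + t • d) x * ((2 * Real.pi * inner ℝ d x : ℝ) * Complex.I)) t := by
  have h : HasDerivAt (fun t : ℝ => 2 * Real.pi * inner ℝ (y + t • d) x)
      (2 * Real.pi * inner ℝ d x) t := by
    simp only [inner_add_left, inner_smul_left, RCLike.conj_to_real]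
    exact ((((hasDerivAt_id' t).mul_const (inner ℝ d x)).const_add (inner ℝ y x)).const_mul
      (2 * Real.pi)).congr_deriv (by ring)
  simp only [phase_eq_exp]
  exact (h.ofReal_comp.mul_const Complex.I).cexp

/-- The coefficients of the derivative of an exponential sum in the `i`-th direction. -/
noncomputable def derivCoeff {n : ℕ} (c : Fin n × Fin n → ℂ) (d : Fin n × Fin n → Space)
    (i : Fin 3) (q : Fin n × Fin n) : ℂ :=
  c q * ((d q i * (n / 8) : ℝ) : ℂ)

lemma continuous_expSum_lineMap {X : Type*} [TopologicalSpace X] {n : ℕ}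
    (c : Fin n × Fin n → ℂ) (y d : Fin n × Fin n → Space) {f : X → ℝ} {g : X → Space}
    (hf : Continuous f) (hg : Continuous g) :
    Continuous fun p => expSum n c (fun q => y q + f p • d q) (g p) := by
  unfold expSum
  refine continuous_finsetSum _ fun q _ => ?_
  have : Continuous fun p => phase (y q + f p • d q) (g p) :=
    continuous_phase.comp ((continuous_const.add (hf.smul continuous_const)).prodMk hg)
  fun_prop

/-- Fundamental theorem of calculus along the segment from `y` to `z`. Points of one box differ by
at most `8/n` in each coordinate, so the factor `n/8` in `derivCoeff` keeps coefficients bounded by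
1 and the derivative is built from sums of the same class. -/
lemma expSum_sub {n : ℕ} (hn : 1 ≤ n) (c : Fin n × Fin n → ℂ) (y z : Fin n × Fin n → Space)
    (x : Space) :
    expSum n c z x - expSum n c y x = ∫ t in Ioc (0 : ℝ) 1, ∑ i : Fin 3,
      ((16 * Real.pi * x i / n : ℝ) * Complex.I) *
        expSum n (derivCoeff c (z - y) i) (fun q => y q + t • (z - y) q) x := by
  have hn' : (n : ℝ) ≠ 0 := by positivity
  have hd : ∀ t : ℝ, HasDerivAt (fun t : ℝ => expSum n c (fun q => y q + t • (z - y) q) x)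
      (∑ i : Fin 3, ((16 * Real.pi * x i / n : ℝ) * Complex.I) *
        expSum n (derivCoeff c (z - y) i) (fun q => y q + t • (z - y) q) x) t := by
    intro t
    unfold expSum
    refine (HasDerivAt.fun_sum fun q _ => ((hasDerivAt_phase (y q) ((z - y) q) x t).const_mul
      (c q)).const_smul ((n : ℝ) ^ 2)⁻¹).congr_deriv ?_
    simp_rw [Finset.mul_sum]
    rw [Finset.sum_comm]
    refine Finset.sum_congr rfl fun q _ => ?_
    have hi : inner ℝ ((z - y) q) x = ∑ i, (z - y) q i * x i := by
      simp [PiLp.inner_apply, mul_comm]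
    rw [hi, Fin.sum_univ_three, Fin.sum_univ_three]
    simp only [derivCoeff, Complex.real_smul]
    have hn'' : (n : ℂ) ≠ 0 := by exact_mod_cast hn'
    push_cast
    field_simp
    ring
  have hcont : Continuous fun t : ℝ => ∑ i : Fin 3, ((16 * Real.pi * x i / n : ℝ) * Complex.I) *
        expSum n (derivCoeff c (z - y) i) (fun q => y q + t • (z - y) q) x := by
    refine continuous_finsetSum _ fun i _ => continuous_const.mul ?_
    exact continuous_expSum_lineMap _ y (z - y) continuous_id continuous_const
  rw [← intervalIntegral.integral_of_le zero_le_one,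
    intervalIntegral.integral_eq_sub_of_hasDerivAt (fun t _ => hd t)
      (hcont.intervalIntegrable _ _)]
  simp

/-- The largest third moment, over the ball of radius `r`, of the exponential sums with bounded
coefficients and frequencies near the paraboloid. -/
noncomputable def expSumSup (n : ℕ) (r : ℝ) : ℝ≥0∞ :=
  ⨆ (c : Fin n × Fin n → ℂ) (_ : ∀ q, ‖c q‖ ≤ 1) (y : Fin n × Fin n → Space) (_ : InBoxes n y),
    ∫⁻ x in Metric.closedBall 0 r, ENNReal.ofReal (‖expSum n c y x‖ ^ 3)

lemma le_expSumSup {n : ℕ} (r : ℝ) {c : Fin n × Fin n → ℂ} (hc : ∀ q, ‖c q‖ ≤ 1)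
    {y : Fin n × Fin n → Space} (hy : InBoxes n y) :
    ∫⁻ x in Metric.closedBall 0 r, ENNReal.ofReal (‖expSum n c y x‖ ^ 3) ≤ expSumSup n r :=
  le_iSup₂_of_le c hc (le_iSup₂_of_le y hy le_rfl)

lemma expSumSup_ne_top (n : ℕ) (r : ℝ) : expSumSup n r ≠ ∞ := by
  have : expSumSup n r ≤ volume (Metric.closedBall (0 : Space) r) := by
    refine iSup₂_le fun c hc => iSup₂_le fun y _ => ?_
    rw [← setLIntegral_one]
    exact lintegral_mono fun x => ENNReal.ofReal_le_one.2
      (pow_le_one₀ (norm_nonneg _) (norm_expSum_le_one hc y x))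
  exact ne_top_of_le_ne_top measure_closedBall_lt_top.ne this

/-- For `|x| ≤ n/320` the factors `16π|xᵢ|/n` are at most 1/6. The cube of a sum over three
directions costs 9, so each direction contributes `9/216 = 1/24` and all three `1/8`. -/
lemma lintegral_expSum_sub_le {n : ℕ} (hn : 1 ≤ n) {r : ℝ} (hr : r ≤ n / 320)
    {c : Fin n × Fin n → ℂ} (hc : ∀ q, ‖c q‖ ≤ 1)
    {y z : Fin n × Fin n → Space} (hy : InBoxes n y) (hz : InBoxes n z) :
    ∫⁻ x in Metric.closedBall 0 r, ENNReal.ofReal (‖expSum n c z x - expSum n c y x‖ ^ 3) ≤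
      ENNReal.ofReal (1 / 8) * expSumSup n r := by
  have hn' : (0 : ℝ) < n := by exact_mod_cast hn
  have : IsProbabilityMeasure (volume.restrict (Ioc (0 : ℝ) 1)) := ⟨by simp⟩
  simp_rw [expSum_sub hn]
  have hcd : ∀ i q, ‖derivCoeff c (z - y) i q‖ ≤ 1 := by
    intro i q
    rw [derivCoeff, norm_mul, Complex.norm_real, Real.norm_eq_abs]
    refine mul_le_one₀ (hc q) (abs_nonneg _) ?_
    rw [abs_mul, abs_of_pos (by positivity : (0 : ℝ) < n / 8)]
    have h2 := abs_le.1 (hy q i)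
    have h3 := abs_le.1 (hz q i)
    have h4 : |(z - y) q i| ≤ 8 / n := by
      have e : (8 : ℝ) / n = 4 / n + 4 / n := by ring
      rw [e, Pi.sub_apply, PiLp.sub_apply, abs_le]
      constructor <;> linarith
    calc _ ≤ 8 / n * (n / 8 : ℝ) := by gcongr
      _ = 1 := by field_simp
  have hcont : ∀ i, Continuous fun p : ℝ × Space =>
      expSum n (derivCoeff c (z - y) i) (fun q => y q + p.1 • (z - y) q) p.2 :=
    fun i => continuous_expSum_lineMap _ y (z - y) continuous_fst continuous_snd
  refine lintegral_norm_integral_pow_three_le (Continuous.measurable ?_) ?_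
  · refine continuous_finsetSum _ fun i _ => Continuous.mul (by fun_prop) (hcont i)
  · filter_upwards [ae_restrict_mem measurableSet_Ioc] with t ht
    have hbox := hy.lineMap hz ht.1.le ht.2
    calc _ ≤ ∫⁻ x in Metric.closedBall 0 r, ENNReal.ofReal (1 / 24) * ∑ i : Fin 3,
          ENNReal.ofReal (‖expSum n (derivCoeff c (z - y) i)
            (fun q => y q + t • (z - y) q) x‖ ^ 3) := by
          refine setLIntegral_mono' measurableSet_closedBall fun x hx => ?_
          rw [← ENNReal.ofReal_sum_of_nonneg fun _ _ => by positivity,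
            ← ENNReal.ofReal_mul (by norm_num)]
          apply ENNReal.ofReal_le_ofReal
          have hco : ∀ i, ‖((16 * Real.pi * x i / n : ℝ) : ℂ) * Complex.I‖ ≤ 1 / 6 := by
            intro i
            rw [norm_mul, Complex.norm_I, mul_one, Complex.norm_real, Real.norm_eq_abs, abs_div,
              abs_mul, abs_of_pos (by positivity : 0 < 16 * Real.pi), abs_of_pos hn',
              div_le_iff₀ hn']
            have h1 : |x i| ≤ n / 320 := by
              rw [mem_closedBall_zero_iff] at hx
              exact (PiLp.norm_apply_le x i).trans (hx.trans hr)
            have h2 := Real.pi_lt_d2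
            calc 16 * Real.pi * |x i| ≤ 16 * 3.15 * (n / 320) := by gcongr
              _ ≤ 1 / 6 * n := by linarith
          have hnorm : ‖∑ i : Fin 3, ((16 * Real.pi * x i / n : ℝ) * Complex.I) *
              expSum n (derivCoeff c (z - y) i) (fun q => y q + t • (z - y) q) x‖ ≤
              1 / 6 * ∑ i : Fin 3, ‖expSum n (derivCoeff c (z - y) i)
                (fun q => y q + t • (z - y) q) x‖ := by
            rw [Finset.mul_sum]
            refine (norm_sum_le _ _).trans (Finset.sum_le_sum fun i _ => ?_)
            rw [norm_mul]
            exact mul_le_mul_of_nonneg_right (hco i) (norm_nonneg _)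
          refine (pow_le_pow_left₀ (norm_nonneg _) hnorm 3).trans ?_
          have hjen := pow_sum_div_card_le_sum_pow (s := Finset.univ) (fun (i : Fin 3) _ =>
            norm_nonneg (expSum n (derivCoeff c (z - y) i) (fun q => y q + t • (z - y) q) x)) 2
          simp only [Finset.card_univ, Fintype.card_fin, Nat.cast_ofNat, Nat.reduceAdd] at hjen
          rw [mul_pow]
          linarith
      _ = ENNReal.ofReal (1 / 24) * ∑ i : Fin 3, ∫⁻ x in Metric.closedBall 0 r,
          ENNReal.ofReal (‖expSum n (derivCoeff c (z - y) i)
            (fun q => y q + t • (z - y) q) x‖ ^ 3) := by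
          rw [lintegral_const_mul' _ _ ENNReal.ofReal_ne_top, lintegral_finsetSum]
          intro i _
          exact ((continuous_expSum_lineMap _ y (z - y) continuous_const
            continuous_id).norm.pow 3).measurable.ennreal_ofReal
      _ ≤ ENNReal.ofReal (1 / 24) * ∑ i : Fin 3, expSumSup n r := by
          gcongr with i
          exact le_expSumSup r (hcd i) hbox
      _ = _ := by
          rw [Finset.sum_const, Finset.card_univ, Fintype.card_fin, nsmul_eq_mul, ← mul_assoc,
            ← ENNReal.ofReal_natCast, ← ENNReal.ofReal_mul (by norm_num)]
          norm_num

lemma integrable_smul_phase_point {n : ℕ} (c : Fin n × Fin n → ℂ) (q : Fin n × Fin n) (x : Space) :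
    Integrable (fun w => ((n : ℝ) ^ 2)⁻¹ • (c q * phase (lift (point n q w)) x)) cellMeasure := by
  have h : Integrable (fun w => phase (lift (point n q w)) x) cellMeasure :=
    Integrable.of_bound (C := 1) (continuous_phase.comp ((continuous_lift.comp
      (continuous_point n q)).prodMk continuous_const)).aestronglyMeasurable
      (.of_forall fun w => by simp)
  have h2 := (h.const_mul (c q)).smul ((n : ℝ) ^ 2)⁻¹
  exact h2

lemma integral_expSum_point {n : ℕ} (c : Fin n × Fin n → ℂ) (x : Space) :
    ∫ w, expSum n c (fun q => lift (point n q w)) x ∂cellMeasure = superposition n c x := by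
  unfold expSum superposition packet
  rw [integral_finsetSum _ fun q _ => integrable_smul_phase_point c q x]
  simp_rw [integral_smul, integral_const_mul]

lemma integrable_expSum_point {n : ℕ} (c : Fin n × Fin n → ℂ) (x : Space) :
    Integrable (fun w => expSum n c (fun q => lift (point n q w)) x) cellMeasure := by
  unfold expSum
  exact integrable_finsetSum _ fun q _ => integrable_smul_phase_point c q x

lemma add_pow_three_le {a b : ℝ} (ha : 0 ≤ a) (hb : 0 ≤ b) :
    (a + b) ^ 3 ≤ 4 * a ^ 3 + 4 * b ^ 3 := by
  nlinarith [mul_nonneg (add_nonneg ha hb) (sq_nonneg (a - b))]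

lemma measurable_phase_lift_point (n : ℕ) (q : Fin n × Fin n) :
    Measurable fun p : Plane × Space => phase (lift (point n q p.1)) p.2 :=
  (continuous_phase.comp (((continuous_lift.comp (continuous_point n q)).comp
    continuous_fst).prodMk continuous_snd)).measurable

/-- A superposition is the average over `w` of the sums with frequencies `lift (point n q w)`.
Comparing an arbitrary sum with this average gives `K ≤ 4T + 4 · K/8` for the finite supremum `K`,
and half of `K` is absorbed. -/
lemma expSumSup_le {n : ℕ} (hn : 1 ≤ n) {r : ℝ} (hr : r ≤ n / 320) {T : ℝ≥0∞}
    (hT : ∀ c : Fin n × Fin n → ℂ, (∀ q, ‖c q‖ ≤ 1) →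
      ∫⁻ x in Metric.closedBall 0 r, ENNReal.ofReal (‖superposition n c x‖ ^ 3) ≤ T) :
    expSumSup n r ≤ 8 * T := by
  set K := expSumSup n r with hK
  have hKt : K ≠ ∞ := expSumSup_ne_top n r
  have h1 : K ≤ 4 * T + ENNReal.ofReal (1 / 2) * K := by
    refine iSup₂_le fun c hc => iSup₂_le fun y hy => ?_
    have hphase : ∀ q, Continuous fun x => phase (y q) x := fun q =>
      continuous_phase.comp (continuous_const.prodMk continuous_id)
    have hmy : Measurable fun x => expSum n c y x := by
      unfold expSum
      exact (continuous_finsetSum _ fun q _ => by fun_prop).measurable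
    have hH : Measurable fun p : Plane × Space => expSum n c y p.2 -
        expSum n c (fun q => lift (point n q p.1)) p.2 := by
      refine (hmy.comp measurable_snd).sub ?_
      unfold expSum
      refine Finset.measurable_sum _ fun q _ => ?_
      have := ((measurable_phase_lift_point n q).const_mul (c q)).const_smul ((n : ℝ) ^ 2)⁻¹
      exact this
    have hdiff := lintegral_norm_integral_pow_three_le (ν := cellMeasure)
      (μ := volume.restrict (Metric.closedBall (0 : Space) r))
      (H := fun w x => expSum n c y x - expSum n c (fun q => lift (point n q w)) x) hH
      (K := ENNReal.ofReal (1 / 8) * K) (by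
        filter_upwards [ae_restrict_mem measurableSet_cell] with w hw
        exact lintegral_expSum_sub_le hn hr hc (inBoxes_point hw) hy)
    have hint : ∀ x, ∫ w, (expSum n c y x - expSum n c (fun q => lift (point n q w)) x)
        ∂cellMeasure = expSum n c y x - superposition n c x := by
      intro x
      rw [integral_sub (integrable_const _) (integrable_expSum_point c x), integral_const,
        integral_expSum_point]
      simp
    simp_rw [hint] at hdiff
    calc _ ≤ ∫⁻ x in Metric.closedBall 0 r,
          (4 * ENNReal.ofReal (‖superposition n c x‖ ^ 3) +
            4 * ENNReal.ofReal (‖expSum n c y x - superposition n c x‖ ^ 3)) := by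
          refine lintegral_mono fun x => ?_
          rw [show (4 : ℝ≥0∞) = ENNReal.ofReal 4 by simp, ← ENNReal.ofReal_mul (by norm_num),
            ← ENNReal.ofReal_mul (by norm_num),
            ← ENNReal.ofReal_add (by positivity) (by positivity)]
          refine ENNReal.ofReal_le_ofReal
            (le_trans ?_ (add_pow_three_le (norm_nonneg _) (norm_nonneg _)))
          refine pow_le_pow_left₀ (norm_nonneg _) ?_ 3
          refine le_trans (le_of_eq ?_) (norm_add_le _ _)
          rw [add_sub_cancel]
      _ = 4 * (∫⁻ x in Metric.closedBall 0 r, ENNReal.ofReal (‖superposition n c x‖ ^ 3)) +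
          4 * ∫⁻ x in Metric.closedBall 0 r,
            ENNReal.ofReal (‖expSum n c y x - superposition n c x‖ ^ 3) := by
          have hms : Measurable fun x => 4 * ENNReal.ofReal (‖superposition n c x‖ ^ 3) :=
            ((continuous_superposition n c).norm.pow 3).measurable.ennreal_ofReal.const_mul _
          rw [lintegral_add_left hms, lintegral_const_mul' _ _ (by simp),
            lintegral_const_mul' _ _ (by simp)]
      _ ≤ 4 * T + 4 * (ENNReal.ofReal (1 / 8) * K) := by
          gcongr
          exact hT c hc
      _ = _ := by
          rw [← mul_assoc, show (4 : ℝ≥0∞) * ENNReal.ofReal (1 / 8) = ENNReal.ofReal (1 / 2) by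
            rw [show (4 : ℝ≥0∞) = ENNReal.ofReal 4 by simp, ← ENNReal.ofReal_mul (by norm_num)]
            norm_num]
  rcases eq_or_ne T ∞ with rfl | hTt
  · simp
  rw [← ENNReal.ofReal_toReal hKt, ← ENNReal.ofReal_toReal hTt,
    show (4 : ℝ≥0∞) = ENNReal.ofReal 4 by simp, ← ENNReal.ofReal_mul (by norm_num),
    ← ENNReal.ofReal_mul (by norm_num),
    ← ENNReal.ofReal_add (by positivity) (by positivity),
    ENNReal.ofReal_le_ofReal_iff (by positivity)] at h1
  rw [← ENNReal.ofReal_toReal hKt, ← ENNReal.ofReal_toReal hTt,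
    show (8 : ℝ≥0∞) = ENNReal.ofReal 8 by simp, ← ENNReal.ofReal_mul (by norm_num)]
  apply ENNReal.ofReal_le_ofReal
  linarith

/-! ### General bounded functions and arbitrary centres -/

/-- Integrating last over the relative position `w` writes `EF` as an average of exponential sums
with coefficients `F (point n q w)`. -/
lemma lintegral_extension_le_expSumSup {n : ℕ} (hn : 1 ≤ n) (r : ℝ) {F : Plane → ℂ}
    (hF : Measurable F) (hF1 : ∀ ξ, ‖F ξ‖ ≤ 1) :
    ∫⁻ x in Metric.closedBall 0 r, ENNReal.ofReal (‖extension unitSquare F x‖ ^ 3) ≤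
      expSumSup n r := by
  have hLp : MemLp F ∞ (volume.restrict unitSquare) :=
    memLp_top_of_bound hF.aestronglyMeasurable 1 (.of_forall hF1)
  have hmq : ∀ q, Measurable fun p : Plane × Space =>
      F (point n q p.1) * phase (lift (point n q p.1)) p.2 := fun q =>
    (hF.comp ((continuous_point n q).measurable.comp measurable_fst)).mul
      (measurable_phase_lift_point n q)
  have hint : ∀ q x, Integrable (fun w => F (point n q w) * phase (lift (point n q w)) x)
      cellMeasure := fun q x =>
    Integrable.of_bound (C := 1) ((hmq q).comp
      (measurable_id.prodMk measurable_const)).aestronglyMeasurable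
      (.of_forall fun w => by simpa using hF1 _)
  have hint' : ∀ q x, Integrable (fun w => ((n : ℝ) ^ 2)⁻¹ •
      (F (point n q w) * phase (lift (point n q w)) x)) cellMeasure := fun q x => by
    have := (hint q x).smul ((n : ℝ) ^ 2)⁻¹
    exact this
  have e : ∀ x, extension unitSquare F x = ∫ w, expSum n (fun q => F (point n q w))
      (fun q => lift (point n q w)) x ∂cellMeasure := by
    intro x
    unfold expSum
    rw [← ensemble_univ hn, extension_ensemble hn _ hLp,
      integral_finsetSum _ fun q _ => hint' q x]
    exact Finset.sum_congr rfl fun q _ => by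
      rw [extension_canonicalSquare hn, integral_smul]
  simp_rw [e]
  refine lintegral_norm_integral_pow_three_le ?_ ?_
  · unfold expSum
    refine Finset.measurable_sum _ fun q _ => ?_
    have := (hmq q).const_smul ((n : ℝ) ^ 2)⁻¹
    exact this
  · filter_upwards [ae_restrict_mem measurableSet_cell] with w hw
    exact le_expSumSup r (fun q => hF1 _) (inBoxes_point hw)

/-- Coefficients are sampled pointwise, so measurability and the bound by 1 are needed everywhere
and not merely almost everywhere. -/
lemma exists_bounded_representative {F : Plane → ℂ}
    (hF : MemLp F ∞ (volume.restrict unitSquare)) :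
    ∃ G : Plane → ℂ, Measurable G ∧ (∀ ξ, ‖G ξ‖ ≤ 1) ∧
      ∀ᵐ ξ ∂volume.restrict unitSquare,
        F ξ = ((eLpNorm F ∞ (volume.restrict unitSquare)).toReal : ℂ) * G ξ := by
  set L := (eLpNorm F ∞ (volume.restrict unitSquare)).toReal with hL
  have hL0 : 0 ≤ L := ENNReal.toReal_nonneg
  have hFL : ∀ᵐ ξ ∂volume.restrict unitSquare, ‖F ξ‖ ≤ L := by
    filter_upwards [ae_le_eLpNormEssSup (f := F) (μ := volume.restrict unitSquare)] with ξ hξ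
    rw [← eLpNorm_exponent_top, ← ENNReal.ofReal_toReal hF.2.ne, ← hL, ← ofReal_norm,
      ENNReal.ofReal_le_ofReal_iff hL0] at hξ
    exact hξ
  obtain ⟨F', hF'm, hF'⟩ := hF.1
  have hG0 : Measurable fun ξ => F' ξ / (L : ℂ) := hF'm.measurable.div_const _
  have hset : MeasurableSet {ξ | ‖F' ξ / (L : ℂ)‖ ≤ 1} :=
    measurableSet_le hG0.norm measurable_const
  refine ⟨{ξ | ‖F' ξ / (L : ℂ)‖ ≤ 1}.indicator fun ξ => F' ξ / (L : ℂ), hG0.indicator hset,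
    fun ξ => ?_, ?_⟩
  · by_cases h : ξ ∈ {ξ | ‖F' ξ / (L : ℂ)‖ ≤ 1}
    · rw [indicator_of_mem h]; exact h
    · rw [indicator_of_notMem h]; simp
  · filter_upwards [hFL, hF'] with ξ h1 h2
    rcases hL0.eq_or_lt with h | h
    · rw [← h] at h1 ⊢
      simpa using h1
    · have h3 : ξ ∈ {ξ | ‖F' ξ / (L : ℂ)‖ ≤ 1} := by
        change ‖F' ξ / (L : ℂ)‖ ≤ 1
        rw [norm_div, Complex.norm_real, Real.norm_of_nonneg hL0, div_le_one h, ← h2]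
        exact h1
      rw [indicator_of_mem h3, ← h2]
      have : (L : ℂ) ≠ 0 := by exact_mod_cast h.ne'
      field_simp

/-- Moving the centre to the origin only multiplies `F` by a unimodular character. -/
lemma lintegral_closedBall_extension_le {n : ℕ} (hn : 1 ≤ n) (r : ℝ) {F : Plane → ℂ}
    (hF : MemLp F ∞ (volume.restrict unitSquare)) (c : Space) :
    ∫⁻ x in Metric.closedBall c r, ‖extension unitSquare F x‖ₑ ^ 3 ≤
      expSumSup n r * eLpNorm F ∞ (volume.restrict unitSquare) ^ 3 := by
  obtain ⟨G, hGm, hG1, hFG⟩ := exists_bounded_representative hF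
  set L := (eLpNorm F ∞ (volume.restrict unitSquare)).toReal with hL
  have hL0 : 0 ≤ L := ENNReal.toReal_nonneg
  have hph : Measurable fun ξ => phase (lift ξ) c :=
    (continuous_phase.comp (continuous_lift.prodMk continuous_const)).measurable
  have e : ∀ x, extension unitSquare F (x + c) =
      L * extension unitSquare (fun ξ => G ξ * phase (lift ξ) c) x := by
    intro x
    rw [extension_eq, extension_eq, ← integral_const_mul]
    refine integral_congr_ae ?_
    filter_upwards [hFG] with ξ hξ
    rw [hξ, phase_add_right]
    ring
  have htr : ∫⁻ x in Metric.closedBall c r, ‖extension unitSquare F x‖ₑ ^ 3 =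
      ∫⁻ x in Metric.closedBall 0 r, ‖extension unitSquare F (x + c)‖ₑ ^ 3 := by
    rw [← lintegral_indicator measurableSet_closedBall,
      ← lintegral_indicator measurableSet_closedBall, ← lintegral_add_right_eq_self _ c]
    refine lintegral_congr fun x => ?_
    by_cases h : x ∈ Metric.closedBall (0 : Space) r
    · have h2 : x + c ∈ Metric.closedBall c r := by
        simpa [dist_eq_norm] using h
      rw [indicator_of_mem h, indicator_of_mem h2]
    · have h2 : x + c ∉ Metric.closedBall c r := by
        simpa [dist_eq_norm] using h
      rw [indicator_of_notMem h, indicator_of_notMem h2]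
  rw [htr]
  have hLe : ENNReal.ofReal L = eLpNorm F ∞ (volume.restrict unitSquare) :=
    ENNReal.ofReal_toReal hF.2.ne
  calc _ = ∫⁻ x in Metric.closedBall 0 r, ENNReal.ofReal (L ^ 3) *
        ENNReal.ofReal (‖extension unitSquare (fun ξ => G ξ * phase (lift ξ) c) x‖ ^ 3) := by
        refine lintegral_congr fun x => ?_
        rw [e, ← ENNReal.rpow_natCast, Nat.cast_ofNat, enorm_rpow_three, norm_mul, mul_pow,
          Complex.norm_real, Real.norm_of_nonneg hL0, ENNReal.ofReal_mul (by positivity)]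
    _ ≤ ENNReal.ofReal (L ^ 3) * expSumSup n r := by
        rw [lintegral_const_mul' _ _ ENNReal.ofReal_ne_top]
        gcongr
        exact lintegral_extension_le_expSumSup hn r (hGm.mul hph) fun ξ => by simpa using hG1 ξ
    _ = _ := by rw [ENNReal.ofReal_pow hL0, hLe, mul_comm]

/-! ### Choice of scales -/

/-- With `n = kl`, `m = k²`, `M = l²` the divisibility is automatic, and `l ≈ k^(1/γ - 1)` forces `n
≈ k^(1/γ)`, that is, `(n²)^γ ≈ k²`. -/
lemma exists_scale {γ A : ℝ} (hγ : 0 < γ) (hγ2 : γ ≤ 1 / 2) (hA : 1 < A) (K : ℝ) :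
    ∃ Λ : ℝ, 0 < Λ ∧ ∀ X : ℝ, 1 ≤ X → ∃ n m M : ℕ, X ≤ n ∧ (n : ℝ) ≤ Λ * X ∧ M * m = n ^ 2 ∧
      A⁻¹ * ((n : ℝ) ^ 2) ^ γ ≤ m ∧ (m : ℝ) ≤ A * ((n : ℝ) ^ 2) ^ γ ∧ K ≤ √m := by
  -- The summands ensure `K ≤ k`, then `1 ≤ (A - 1) k`, so that rounding `l` up costs at most a
  -- factor `A`, and finally `1 ≤ k`.
  set k₀ : ℕ := ⌈|K|⌉₊ + ⌈1 / (A - 1)⌉₊ + 1 with hk₀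
  refine ⟨2 * (k₀ + 2 : ℝ) ^ (1 / γ), by positivity, fun X hX => ?_⟩
  set k : ℕ := ⌈X ^ γ⌉₊ + k₀ with hk
  set l : ℕ := ⌈(k : ℝ) ^ (1 / γ - 1)⌉₊ with hl
  have hk1 : (1 : ℝ) ≤ k := by
    have : 1 ≤ k := by omega
    exact_mod_cast this
  have hk0 : (0 : ℝ) < k := by linarith
  have hX0 : 0 < X := by linarith
  have hg1 : 2 ≤ 1 / γ := by rw [le_div_iff₀ hγ]; linarith
  have hKk : K ≤ k := by
    have h1 := Nat.le_ceil |K|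
    have h2 : (⌈|K|⌉₊ : ℝ) ≤ k := by
      have : ⌈|K|⌉₊ ≤ k := by omega
      exact_mod_cast this
    linarith [le_abs_self K]
  have hAk : 1 ≤ (A - 1) * k := by
    have h1 := Nat.le_ceil (1 / (A - 1))
    have h2 : (⌈1 / (A - 1)⌉₊ : ℝ) ≤ k := by
      have : ⌈1 / (A - 1)⌉₊ ≤ k := by omega
      exact_mod_cast this
    have h3 := (div_le_iff₀ (by linarith : 0 < A - 1)).1 (h1.trans h2)
    linarith
  have hXk : X ^ γ ≤ k := by
    have h1 := Nat.le_ceil (X ^ γ)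
    have h2 : (⌈X ^ γ⌉₊ : ℝ) ≤ k := by
      have : ⌈X ^ γ⌉₊ ≤ k := by omega
      exact_mod_cast this
    linarith
  have hkX : (k : ℝ) ≤ (k₀ + 2) * X ^ γ := by
    have h1 : (⌈X ^ γ⌉₊ : ℝ) < X ^ γ + 1 := Nat.ceil_lt_add_one (by positivity)
    have h2 : 1 ≤ X ^ γ := Real.one_le_rpow hX hγ.le
    have h3 : (k : ℝ) = ⌈X ^ γ⌉₊ + k₀ := by rw [hk]; push_cast; ring
    have h4 : (0 : ℝ) ≤ k₀ := by positivity
    nlinarith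
  have hl1 : (k : ℝ) ^ (1 / γ - 1) ≤ l := Nat.le_ceil _
  have hl2 : (l : ℝ) ≤ (k : ℝ) ^ (1 / γ - 1) + 1 := (Nat.ceil_lt_add_one (by positivity)).le
  have hkk : (k : ℝ) * (k : ℝ) ^ (1 / γ - 1) = (k : ℝ) ^ (1 / γ) := by
    rw [mul_comm, ← Real.rpow_add_one hk0.ne', sub_add_cancel]
  have hnl : (k : ℝ) ^ (1 / γ) ≤ (k : ℝ) * l := by
    rw [← hkk]; gcongr
  have hnu : (k : ℝ) * l ≤ A * (k : ℝ) ^ (1 / γ) := by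
    have h1 : (k : ℝ) ≤ (k : ℝ) ^ (1 / γ - 1) := by
      conv_lhs => rw [← Real.rpow_one (k : ℝ)]
      exact Real.rpow_le_rpow_of_exponent_le hk1 (by linarith)
    have h2 : (k : ℝ) * l ≤ (k : ℝ) ^ (1 / γ) + k := by
      rw [← hkk]
      calc _ ≤ (k : ℝ) * ((k : ℝ) ^ (1 / γ - 1) + 1) := by gcongr
        _ = _ := by ring
    have h3 : (k : ℝ) ≤ (A - 1) * (k : ℝ) ^ (1 / γ) := by
      rw [← hkk]
      calc (k : ℝ) = 1 * k := (one_mul _).symm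
        _ ≤ ((A - 1) * k) * (k : ℝ) ^ (1 / γ - 1) := by gcongr
        _ = _ := by ring
    linarith
  have hnu2 : (k : ℝ) * l ≤ 2 * (k : ℝ) ^ (1 / γ) := by
    have h1 : (1 : ℝ) ≤ (k : ℝ) ^ (1 / γ - 1) := Real.one_le_rpow hk1 (by linarith)
    rw [← hkk]
    calc _ ≤ (k : ℝ) * ((k : ℝ) ^ (1 / γ - 1) + (k : ℝ) ^ (1 / γ - 1)) := by gcongr; linarith
      _ = _ := by ring
  have hkg : ((k : ℝ) ^ (1 / γ)) ^ γ = k := by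
    rw [← Real.rpow_mul hk0.le, one_div_mul_cancel hγ.ne', Real.rpow_one]
  have hsq : ∀ t : ℝ, 0 ≤ t → (t ^ 2) ^ γ = (t ^ γ) ^ 2 := by
    intro t ht
    rw [← Real.rpow_natCast, ← Real.rpow_natCast, ← Real.rpow_mul ht, ← Real.rpow_mul ht, mul_comm]
  refine ⟨k * l, k ^ 2, l ^ 2, ?_, ?_, by ring, ?_, ?_, ?_⟩
  · push_cast
    refine le_trans ?_ hnl
    calc X = (X ^ γ) ^ (1 / γ) := by
          rw [← Real.rpow_mul hX0.le, mul_one_div_cancel hγ.ne', Real.rpow_one]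
      _ ≤ _ := by gcongr
  · push_cast
    refine hnu2.trans ?_
    calc _ ≤ 2 * ((k₀ + 2) * X ^ γ) ^ (1 / γ) := by gcongr
      _ = _ := by
          rw [Real.mul_rpow (by positivity) (by positivity), ← Real.rpow_mul hX0.le,
            mul_one_div_cancel hγ.ne', Real.rpow_one]
          ring
  · push_cast
    rw [inv_mul_le_iff₀ (by linarith), hsq _ (by positivity)]
    have h1 : ((k : ℝ) * l) ^ γ ≤ A ^ γ * k := by
      refine (Real.rpow_le_rpow (by positivity) hnu hγ.le).trans (le_of_eq ?_)
      rw [Real.mul_rpow (by linarith) (by positivity), hkg]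
    have h2 : (A ^ γ) ^ 2 ≤ A := by
      rw [← Real.rpow_natCast, ← Real.rpow_mul (by linarith)]
      conv_rhs => rw [← Real.rpow_one A]
      refine Real.rpow_le_rpow_of_exponent_le hA.le ?_
      push_cast
      linarith
    calc _ ≤ (A ^ γ * k) ^ 2 := by gcongr
      _ = (A ^ γ) ^ 2 * (k : ℝ) ^ 2 := by ring
      _ ≤ _ := by gcongr
  · push_cast
    rw [hsq _ (by positivity)]
    have h1 : (k : ℝ) ≤ ((k : ℝ) * l) ^ γ := by
      conv_lhs => rw [← hkg]
      gcongr
    calc (k : ℝ) ^ 2 = 1 * (k : ℝ) ^ 2 := (one_mul _).symm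
      _ ≤ _ := by gcongr
  · push_cast
    rw [Real.sqrt_sq hk0.le]
    exact hKk

end LargeEnsemble

/-! ### Conclusion -/

theorem corollary2p2 (N : ℝ) (hN : 3 < N)
    (hdec : ∀ γ₀ : ℝ, 0 < γ₀ → ∃ γ : ℝ, 0 < γ ∧ γ < γ₀ ∧
      ∃ A : ℝ, 1 < A ∧ LargeEnsemble.LargeEnsembleDecoupling 3 γ A N) :
    ∀ ε : ℝ, 0 < ε → ∃ C : ℝ, ∀ R : ℝ, 1 ≤ R →
      ∀ F : LargeEnsemble.Plane → ℂ,
        MemLp F ∞ (volume.restrict LargeEnsemble.unitSquare) → ∀ c : LargeEnsemble.Space,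
        ∫⁻ x in Metric.closedBall c (Real.sqrt R),
            ‖LargeEnsemble.extension LargeEnsemble.unitSquare F x‖ₑ ^ 3 ≤
          ENNReal.ofReal (C * R ^ ε) *
            eLpNorm F ∞ (volume.restrict LargeEnsemble.unitSquare) ^ 3 := by
  intro ε hε
  -- With `δ = ε` the loss is `n^(5γ + ε)`, which `γ < ε/5` keeps below `n^(2ε) ≈ R^ε`. The bound
  -- 1/2 is what `exists_scale` requires.
  obtain ⟨γ, hγ, hγ', A, hA, hD⟩ := hdec (min (ε / 5) (1 / 2)) (by positivity)
  have hγε : 5 * γ ≤ ε := by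
    have := hγ'.le.trans (min_le_left _ _)
    linarith
  have hγ2 : γ ≤ 1 / 2 := hγ'.le.trans (min_le_right _ _)
  obtain ⟨C, K, hC, hsup⟩ := LargeEnsemble.superposition_bound hN hA hγ hD hε
  obtain ⟨Λ, hΛ, hscale⟩ := LargeEnsemble.exists_scale hγ hγ2 hA K
  refine ⟨8 * C * (Λ * 320) ^ (2 * ε), fun R hR F hF c => ?_⟩
  have hR0 : 0 < R := by linarith
  have hs1 : 1 ≤ √R := Real.one_le_sqrt.2 hR
  -- The factor 320 puts `√R` within the radius `n/320` allowed by `expSumSup_le`.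
  obtain ⟨n, m, M, hXn, hnX, hM, hm1, hm2, hK⟩ := hscale (320 * √R) (by linarith)
  have hn1 : (1 : ℝ) ≤ n := by linarith
  have hn : 1 ≤ n := by exact_mod_cast hn1
  refine (LargeEnsemble.lintegral_closedBall_extension_le hn _ hF c).trans
    (mul_le_mul_left ?_ _)
  have hr : √R ≤ n / 320 := by rw [le_div_iff₀ (by norm_num)]; linarith
  refine (LargeEnsemble.expSumSup_le hn hr (T := ENNReal.ofReal (C * n ^ (5 * γ + ε)))
    fun a ha => ?_).trans ?_
  · refine le_trans (lintegral_mono_set (Metric.closedBall_subset_closedBall ?_))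
      (hsup n m M hn hM hm1 hm2 hK a ha 0)
    nlinarith
  · rw [show (8 : ℝ≥0∞) = ENNReal.ofReal 8 by simp, ← ENNReal.ofReal_mul (by norm_num)]
    apply ENNReal.ofReal_le_ofReal
    have h1 : (n : ℝ) ^ (5 * γ + ε) ≤ (Λ * 320) ^ (2 * ε) * R ^ ε := by
      calc (n : ℝ) ^ (5 * γ + ε) ≤ (n : ℝ) ^ (2 * ε) :=
            Real.rpow_le_rpow_of_exponent_le hn1 (by linarith)
        _ ≤ (Λ * 320 * √R) ^ (2 * ε) := by
            refine Real.rpow_le_rpow (by positivity) ?_ (by positivity)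
            linarith
        _ = (Λ * 320) ^ (2 * ε) * R ^ ε := by
            rw [Real.mul_rpow (by positivity) (by positivity), Real.sqrt_eq_rpow,
              ← Real.rpow_mul hR0.le]
            congr 2
            ring
    calc _ ≤ 8 * (C * ((Λ * 320) ^ (2 * ε) * R ^ ε)) := by gcongr
      _ = _ := by ring
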